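/- All graphs are finite, simple and undirected. For a graph $G=(V,E)$, a vertex $x$ and an integer $k\ge 0$, let $B_G(x,k)$ be the set of vertices at distance at most $k$ from $x$ in $G$ (the distance is $+\infty$ between different components). For an integer $\ell\ge 0$, let $\nu_\ell$ be the maximum number of pairwise disjoint members of $\{B_G(x,\ell) : x\in V\}$, and let $\tau_\ell$ be the minimum size of a set of vertices that intersects every $B_G(x,\ell)$, $x\in V$. A set $X\subseteq V$ is 2-shattered in $G$ if for every $Y\subseteq X$ with $|Y|=2$ there are $x\in V$ and $k\ge 0$ with $B_G(x,k)\cap X=Y$. The distance 2VC-dimension of $G$ is the maximum, over all induced subgraphs $G'$ of $G$, of the size of a set that is 2-shattered in $G'$ (distances being taken in $G'$). **Corollary.** (a) Let $d\ge 0$ be an integer. For every graph $G$ of distance 2VC-dimension at most $d$ and every integer $\ell\ge 0$, $$\tau_\ell \;\le\; 11\cdot d^2\cdot (d+\nu_\ell+3)\cdot\binom{d+\nu_\ell}{d}^2 .$$ (b) For every fixed $d$ this bound is a polynomial in $\nu_\ell$, of degree at most $2d+1$: there is a polynomial $p_d\in\mathbb{Q}[t]$ with $\deg p_d\le 2d+1$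 and $p_d(n)=11 d^2(d+n+3)\binom{d+n}{d}^2$ for all integers $n\ge 0$. (c) For every integer $\ell\ge 0$, every planar graph $G$ of diameter at most $2\ell$ has a set $D$ of at most $35200$ vertices such that every vertex of $G$ is at distance at most $\ell$ from a vertex of $D$. -/

import Mathlib

namespace Hypergraph

variable {α : Type*}

/-- `X` is a hitting set: a set of vertices that meets every hyperedge. -/
def IsHittingSet (H : Hypergraph α) (X : Set α) : Prop :=
  X ⊆ H.vertexSet ∧ ∀ e ∈ H.edgeSet, (e ∩ X).Nonempty

/-- `M` is a set of pairwise disjoint hyperedges. -/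
def IsPacking (H : Hypergraph α) (M : Set (Set α)) : Prop :=
  M ⊆ H.edgeSet ∧ M.PairwiseDisjoint id

/-- `X` is 2-shattered: every subset of `X` of size 2 is the trace of a hyperedge on `X`. -/
def IsTwoShattered (H : Hypergraph α) (X : Set α) : Prop :=
  X ⊆ H.vertexSet ∧ ∀ Y ⊆ X, Y.ncard = 2 → ∃ e ∈ H.edgeSet, e ∩ X = Y

/-- The transversality `τ`: the minimum size of a hitting set. It is used only for hypergraphs
on finitely many vertices without empty hyperedge, for which a hitting set exists. -/
noncomputable def transversality (H : Hypergraph α) : ℕ :=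
  sInf {n | ∃ X : Finset α, H.IsHittingSet ↑X ∧ X.card = n}

/-- The packing number `ν`: the maximum number of pairwise disjoint hyperedges. It is used only
for hypergraphs on finitely many vertices, for which the maximum exists. -/
noncomputable def packingNumber (H : Hypergraph α) : ℕ :=
  sSup {n | ∃ M : Finset (Set α), H.IsPacking ↑M ∧ M.card = n}

/-- The 2VC-dimension: the maximum size of a 2-shattered set. It is used only for hypergraphs
on finitely many vertices, for which the maximum exists. -/
noncomputable def twoVCDim (H : Hypergraph α) : ℕ :=
  sSup {n | ∃ X : Finset α, H.IsTwoShattered ↑X ∧ X.card = n}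

end Hypergraph

namespace SimpleGraph

variable {V : Type*}

/-- The ball `B(x, k)`: all vertices at distance at most `k` from `x`, where the distance between
vertices of different components is infinite. -/
def distBall (G : SimpleGraph V) (x : V) (k : ℕ) : Set V :=
  {y | G.edist x y ≤ k}

/-- The `B_ℓ`-hypergraph of `G`: its hyperedges are the balls of radius `ℓ`. -/
def ballHypergraph (G : SimpleGraph V) (l : ℕ) : Hypergraph V where
  vertexSet := Set.univ
  edgeSet := {e | ∃ x, e = G.distBall x l}
  subset_vertexSet_of_mem_edgeSet' := fun _ _ => Set.subset_univ _

/-- The `B`-hypergraph of `G`: its hyperedges are the balls of all radii. -/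
def allBallsHypergraph (G : SimpleGraph V) : Hypergraph V where
  vertexSet := Set.univ
  edgeSet := {e | ∃ x l, e = G.distBall x l}
  subset_vertexSet_of_mem_edgeSet' := fun _ _ => Set.subset_univ _

/-- The distance 2VC-dimension of a finite graph `G`: the maximum, over all induced subgraphs of `G`,
of the 2VC-dimension of the `B`-hypergraph of the subgraph (so that distances are taken inside the
subgraph). -/
noncomputable def distTwoVCDim (G : SimpleGraph V) : ℕ :=
  ⨆ S : Set V, (G.induce S).allBallsHypergraph.twoVCDim

/-- `D` is a dominating set of `G` at distance `ℓ`. -/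
def IsDominatingAt (G : SimpleGraph V) (l : ℕ) (D : Set V) : Prop :=
  ∀ v, ∃ x ∈ D, G.edist x v ≤ l

/-- `A` is a (simple) arc in the Euclidean plane with endpoints `a` and `b`: the image of an
injective continuous path from `a` to `b`. -/
def IsPlaneArc (A : Set (EuclideanSpace ℝ (Fin 2))) (a b : EuclideanSpace ℝ (Fin 2)) : Prop :=
  ∃ γ : _root_.Path a b, Function.Injective γ ∧ Set.range γ = A

/-- A crossing-free drawing of `G` in the Euclidean plane. -/
structure PlaneEmbedding (G : SimpleGraph V) where
  /-- The points that represent the vertices. -/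
  point : V → EuclideanSpace ℝ (Fin 2)
  /-- The arcs that represent the edges. -/
  arc : G.edgeSet → Set (EuclideanSpace ℝ (Fin 2))
  /-- Distinct vertices are distinct points. -/
  point_injective : Function.Injective point
  /-- The edge `uv` is drawn as an arc between the points of `u` and `v`. -/
  isPlaneArc : ∀ (u v : V) (h : s(u, v) ∈ G.edgeSet),
    IsPlaneArc (arc ⟨s(u, v), h⟩) (point u) (point v)
  /-- The arc of an edge contains the points of no other vertices than the ends of the edge. -/
  mem_of_point_mem : ∀ (e : G.edgeSet) (w : V), point w ∈ arc e → w ∈ (e : Sym2 V)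
  /-- The arcs of two distinct edges meet only in points of common ends of these edges. -/
  inter_subset : ∀ e f : G.edgeSet, e ≠ f →
    arc e ∩ arc f ⊆ point '' {w | w ∈ (e : Sym2 V) ∧ w ∈ (f : Sym2 V)}

/-- A graph is planar if it can be drawn in the plane without crossings. -/
def IsPlanar (G : SimpleGraph V) : Prop :=
  Nonempty G.PlaneEmbedding

end SimpleGraph

/-! The bound comes from a theorem on set families. Suppose that at most `ν` members are disjoint
and that no `d + 1` members are pair-shattered (each two have a common point outside the others).
Put `R = (d + ν).choose d`. By minimax with threshold `1 / (4R²)`, either some weights on points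
give every set at least this weight, or some weights on sets load every point with less.

In the second case, sample `2R` sets and choose a point for every pair, common to both if they meet.
On average at most `R` triples have the point of a pair in the third set. Deleting the third sets
leaves `R` samples, where Ramsey's theorem finds `d + 1` pair-shattered sets or `ν + 1` disjoint
ones, a contradiction. In the first case the VC-dimension is below `(d + 1).choose 2`, and the ε-net
theorem gives the hitting set.

For balls of one radius, `v ∈ B(x)` iff `x ∈ B(v)`, so pair-shattered balls are 2-shattered centres.
In a planar graph five such centres would give a drawing of `K₅` along shortest walks in which
disjoint edges never meet. Continuous logarithms exclude this by parity of winding numbers: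
`no_winding_data_fin_five`. Hence `d = 4` serves there, and diameter at most `2l` gives `ν = 1`. -/

/-! ### Continuous logarithms and drawings of `K₅` -/

section Winding

/-- `c` is the increment over `[0, 1]` of a continuous logarithm of `f`. -/
def IsLogIncrement (f : C(ℝ, ℂ)) (c : ℂ) : Prop :=
  ∃ g : C(ℝ, ℂ), (∀ t, Complex.exp (g t) = f t) ∧ g 1 - g 0 = c

theorem exists_continuous_log {A : Type*} [TopologicalSpace A] [SimplyConnectedSpace A]
    [LocallyPathConnectedSpace A] (f : C(A, ℂ)) (hf : ∀ a, f a ≠ 0) :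
    ∃ g : C(A, ℂ), ∀ a, Complex.exp (g a) = f a := by
  obtain ⟨a₀⟩ : Nonempty A := inferInstance
  obtain ⟨g, ⟨-, hg⟩, -⟩ := Complex.isCoveringMapOn_exp.existsUnique_continuousMap_lifts f
    (Complex.exp_log (hf a₀)) (fun a ↦ hf a)
  exact ⟨g, fun a ↦ congrFun hg a⟩

namespace IsLogIncrement

variable {f : C(ℝ, ℂ)} {c c' : ℂ}

theorem exists_of_ne_zero (f : C(ℝ, ℂ)) (hf : ∀ t, f t ≠ 0) : ∃ c, IsLogIncrement f c :=
  let ⟨g, hg⟩ := exists_continuous_log f hf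
  ⟨_, g, hg, rfl⟩

/-- After a constant shift the two logarithms agree at `0`, so they are the same lift of `f` through
the exponential covering. -/
theorem unique (h : IsLogIncrement f c) (h' : IsLogIncrement f c') : c = c' := by
  obtain ⟨g, hg, rfl⟩ := h
  obtain ⟨g', hg', rfl⟩ := h'
  have hf : ∀ t, f t ∈ ({0}ᶜ : Set ℂ) := fun t ↦ by
    rw [← hg t]; exact Complex.exp_ne_zero _
  have hf0 : f 0 ≠ 0 := hf 0
  have hu := (Complex.isCoveringMapOn_exp.existsUnique_continuousMap_lifts f (hg 0) hf).unique
    (y₁ := g) (y₂ := g' + ContinuousMap.const ℝ (g 0 - g' 0)) ⟨rfl, funext hg⟩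
    ⟨by simp, funext fun t ↦ by simp [Complex.exp_add, Complex.exp_sub, hg, hg', div_self hf0]⟩
  have h1 := congrArg (fun k : C(ℝ, ℂ) ↦ k 1) hu
  simp only [ContinuousMap.add_apply, ContinuousMap.const_apply] at h1
  rw [h1]; ring

theorem neg (h : IsLogIncrement f c) : IsLogIncrement (-f) c := by
  obtain ⟨g, hg, rfl⟩ := h
  exact ⟨g + ContinuousMap.const ℝ (Real.pi * Complex.I),
    fun t ↦ by simp [Complex.exp_add, hg], by simp⟩

theorem exp_eq (h : IsLogIncrement f c) : Complex.exp c = f 1 / f 0 := by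
  obtain ⟨g, hg, rfl⟩ := h
  rw [Complex.exp_sub, hg, hg]

/-- The increments around the boundary of a square add up to zero. -/
theorem square (F : C(ℝ × ℝ, ℂ)) (hF : ∀ x, F x ≠ 0) {f₁ f₂ f₃ f₄ : C(ℝ, ℂ)} {a b c d : ℂ}
    (h₁ : ∀ s, f₁ s = F (s, 0)) (h₂ : ∀ t, f₂ t = F (1, t))
    (h₃ : ∀ t, f₃ t = F (0, t)) (h₄ : ∀ s, f₄ s = F (s, 1))
    (ha : IsLogIncrement f₁ a) (hb : IsLogIncrement f₂ b)
    (hc : IsLogIncrement f₃ c) (hd : IsLogIncrement f₄ d) : a + b = c + d := by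
  obtain ⟨g, hg⟩ := exists_continuous_log F hF
  have e₁ := ha.unique ⟨g.comp ⟨fun s ↦ (s, 0), by fun_prop⟩, fun s ↦ by simp [hg, h₁], rfl⟩
  have e₂ := hb.unique ⟨g.comp ⟨fun t ↦ (1, t), by fun_prop⟩, fun s ↦ by simp [hg, h₂], rfl⟩
  have e₃ := hc.unique ⟨g.comp ⟨fun t ↦ (0, t), by fun_prop⟩, fun s ↦ by simp [hg, h₃], rfl⟩
  have e₄ := hd.unique ⟨g.comp ⟨fun s ↦ (s, 1), by fun_prop⟩, fun s ↦ by simp [hg, h₄], rfl⟩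
  rw [e₁, e₂, e₃, e₄]
  simp only [ContinuousMap.comp_apply, ContinuousMap.coe_mk]
  ring

end IsLogIncrement

/-- No values `θ i j k` behave like the increments of `log (γ i j - p k)` for a drawing of `K₅` with
arcs `γ i j` from `p i` to `p j` in which no two disjoint edges meet. -/
theorem no_winding_data_fin_five (p : Fin 5 → ℂ) (θ : Fin 5 → Fin 5 → Fin 5 → ℂ)
    (hp : ∀ i j, i ≠ j → p i ≠ p j)
    (hexp : ∀ i j k, i ≠ j → i ≠ k → j ≠ k →
      Complex.exp (θ i j k) = (p j - p k) / (p i - p k))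
    (hsq : ∀ i j k l, i ≠ j → i ≠ k → i ≠ l → j ≠ k → j ≠ l → k ≠ l →
      θ i j k + θ k l j = θ k l i + θ i j l) : False := by
  have hsub : ∀ i j, i ≠ j → p i - p j ≠ 0 := fun i j h ↦ sub_ne_zero.2 (hp i j h)
  have hpi : (2 * Real.pi * Complex.I : ℂ) ≠ 0 := Complex.two_pi_I_ne_zero
  -- `N a b c l` is the winding number of the triangle `abc` around `p l`. For coinciding indices it
  -- is a dummy value, needed only for `choose`.
  have hN : ∀ a b c l, ∃ n : ℤ, a ≠ b → a ≠ c → a ≠ l → b ≠ c → b ≠ l → c ≠ l →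
      θ a b l + θ b c l - θ a c l = n * (2 * Real.pi * Complex.I) := by
    intro a b c l
    by_cases h : a ≠ b ∧ a ≠ c ∧ a ≠ l ∧ b ≠ c ∧ b ≠ l ∧ c ≠ l
    · obtain ⟨hab, hac, hal, hbc, hbl, hcl⟩ := h
      have : Complex.exp (θ a b l + θ b c l - θ a c l) = 1 := by
        rw [Complex.exp_sub, Complex.exp_add, hexp a b l hab hal hbl, hexp b c l hbc hbl hcl,
          hexp a c l hac hal hcl]
        have := hsub a l hal
        have := hsub b l hbl
        have := hsub c l hcl
        field_simp
      obtain ⟨n, hn⟩ := Complex.exp_eq_one_iff.1 this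
      exact ⟨n, fun _ _ _ _ _ _ ↦ hn⟩
    · exact ⟨0, fun h1 h2 h3 h4 h5 h6 ↦ absurd ⟨h1, h2, h3, h4, h5, h6⟩ h⟩
  choose N hN using hN
  -- The edge `lm` avoids the triangle `abc`, so both its ends have the same winding number.
  have hedge : ∀ a b c l m, a ≠ b → a ≠ c → a ≠ l → b ≠ c → b ≠ l → c ≠ l → a ≠ m → b ≠ m →
      c ≠ m → l ≠ m → N a b c l = N a b c m := by
    intro a b c l m hab hac hal hbc hbl hcl ham hbm hcm hlm
    have h1 := hN a b c l hab hac hal hbc hbl hcl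
    have h2 := hN a b c m hab hac ham hbc hbm hcm
    have e1 := hsq a b l m hab hal ham hbl hbm hlm
    have e2 := hsq b c l m hbc hbl hbm hcl hcm hlm
    have e3 := hsq a c l m hac hal ham hcl hcm hlm
    have : (N a b c l : ℂ) * (2 * Real.pi * Complex.I) = N a b c m * (2 * Real.pi * Complex.I) := by
      rw [← h1, ← h2]; linear_combination e1 + e2 - e3
    exact_mod_cast mul_right_cancel₀ hpi this
  -- By `hsq` for the three pairs of opposite edges, the alternating sum, times `2πi`, is twice a
  -- quantity whose exponential is `-1`; hence it is odd.
  have hquad : ∀ a b c d, a ≠ b → a ≠ c → a ≠ d → b ≠ c → b ≠ d → c ≠ d →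
      ∃ n : ℤ, N a b d c - N a b c d + N a c d b - N b c d a = 2 * n + 1 := by
    intro a b c d hab hac had hbc hbd hcd
    have h1 := hN a b d c hab had hac hbd hbc hcd.symm
    have h2 := hN a b c d hab hac had hbc hbd hcd
    have h3 := hN a c d b hac had hab hcd hbc.symm hbd.symm
    have h4 := hN b c d a hbc hbd hab.symm hcd hac.symm had.symm
    have e1 := hsq a b c d hab hac had hbc hbd hcd
    have e2 := hsq a c b d hac hab had hbc.symm hcd hbd
    have e3 := hsq a d b c had hab hac hbd.symm hcd.symm hbc
    have hx : Complex.exp (θ a c b + θ b d c - (θ a d b + θ b c d) - Real.pi * Complex.I) = 1 := by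
      rw [Complex.exp_sub, Complex.exp_sub, Complex.exp_add, Complex.exp_add, Complex.exp_pi_mul_I,
        hexp a c b hac hab hbc.symm, hexp b d c hbd hbc hcd.symm, hexp a d b had hab hbd.symm,
        hexp b c d hbc hbd hcd]
      have := hsub a b hab
      have := hsub b c hbc
      have h5 : p c - p b = -(p b - p c) := by ring
      have := hsub b d hbd
      have h6 : p d - p b = -(p b - p d) := by ring
      have := hsub c d hcd
      have h7 : p d - p c = -(p c - p d) := by ring
      rw [h5, h6, h7]
      field_simp
    obtain ⟨n, hn⟩ := Complex.exp_eq_one_iff.1 hx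
    refine ⟨n, ?_⟩
    have : ((N a b d c : ℂ) - N a b c d + N a c d b - N b c d a) * (2 * Real.pi * Complex.I) =
        (2 * n + 1) * (2 * Real.pi * Complex.I) := by
      linear_combination -h1 + h2 - h3 + h4 + e1 - e2 + e3 + 2 * hn
    exact_mod_cast mul_right_cancel₀ hpi this
  obtain ⟨n0, q0⟩ := hquad 1 2 3 4 (by decide) (by decide) (by decide) (by decide) (by decide) (by decide)
  obtain ⟨n1, q1⟩ := hquad 0 2 3 4 (by decide) (by decide) (by decide) (by decide) (by decide) (by decide)
  obtain ⟨n2, q2⟩ := hquad 0 1 3 4 (by decide) (by decide) (by decide) (by decide) (by decide) (by decide)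
  obtain ⟨n3, q3⟩ := hquad 0 1 2 4 (by decide) (by decide) (by decide) (by decide) (by decide) (by decide)
  obtain ⟨n4, q4⟩ := hquad 0 1 2 3 (by decide) (by decide) (by decide) (by decide) (by decide) (by decide)
  -- Each of the ten triangles lies in exactly two of the five quadruples, with equal winding
  -- numbers, so the five odd sums would have an even total.
  have hedge' : ∀ a b c l m, [a, b, c, l, m].Nodup → N a b c l = N a b c m := by
    intro a b c l m h
    simp only [List.nodup_cons, List.mem_cons, List.not_mem_nil, or_false, not_or] at h
    apply hedge <;> tauto
  have t0 := hedge' 0 1 2 3 4 (by decide)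
  have t1 := hedge' 0 1 3 2 4 (by decide)
  have t2 := hedge' 0 1 4 2 3 (by decide)
  have t3 := hedge' 0 2 3 1 4 (by decide)
  have t4 := hedge' 0 2 4 1 3 (by decide)
  have t5 := hedge' 0 3 4 1 2 (by decide)
  have t6 := hedge' 1 2 3 0 4 (by decide)
  have t7 := hedge' 1 2 4 0 3 (by decide)
  have t8 := hedge' 1 3 4 0 2 (by decide)
  have t9 := hedge' 2 3 4 0 1 (by decide)
  omega

/-- In every continuous map of `K₅` to the plane, the images of some two disjoint edges meet. -/
theorem exists_disjoint_edges_meet (p : Fin 5 → ℂ) (γ : ∀ i j, Path (p i) (p j)) :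
    ∃ i j k l, [i, j, k, l].Nodup ∧ ∃ s t, γ i j s = γ k l t := by
  by_contra! H
  have hne : ∀ i j k l, i ≠ j → i ≠ k → i ≠ l → j ≠ k → j ≠ l → k ≠ l → ∀ s t : ℝ,
      (γ i j).extend s - (γ k l).extend t ≠ 0 := by
    intro i j k l hij hik hil hjk hjl hkl s t
    exact sub_ne_zero.2 (H i j k l (by simp [*]) _ _)
  have h4 : ∀ i j k : Fin 5, ∃ l, i ≠ l ∧ j ≠ l ∧ k ≠ l := by decide
  have hpt : ∀ i j k, i ≠ j → i ≠ k → j ≠ k → ∀ s : ℝ, (γ i j).extend s - p k ≠ 0 := by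
    intro i j k hij hik hjk s
    -- `p k` is the start of an edge `kl` disjoint from `ij`.
    obtain ⟨l, hil, hjl, hkl⟩ := h4 i j k
    simpa using hne i j k l hij hik hil hjk hjl hkl s 0
  let f : Fin 5 → Fin 5 → Fin 5 → C(ℝ, ℂ) := fun i j k ↦
    ⟨fun s ↦ (γ i j).extend s - p k, by fun_prop⟩
  have hθ : ∀ i j k, ∃ c, i ≠ j → i ≠ k → j ≠ k → IsLogIncrement (f i j k) c := by
    intro i j k
    by_cases h : i ≠ j ∧ i ≠ k ∧ j ≠ k
    · obtain ⟨c, hc⟩ := IsLogIncrement.exists_of_ne_zero (f i j k) (hpt i j k h.1 h.2.1 h.2.2)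
      exact ⟨c, fun _ _ _ ↦ hc⟩
    · exact ⟨0, fun h1 h2 h3 ↦ absurd ⟨h1, h2, h3⟩ h⟩
  choose θ hθ using hθ
  refine no_winding_data_fin_five p θ (fun i j hij ↦ ?_) (fun i j k hij hik hjk ↦ ?_)
    (fun i j k l hij hik hil hjk hjl hkl ↦ ?_)
  · obtain ⟨l, hil, hjl, -⟩ := h4 i j j
    have := hpt i l j hil hij hjl.symm 0
    rw [Path.extend_zero] at this
    exact sub_ne_zero.1 this
  · simpa [f] using (hθ i j k hij hik hjk).exp_eq
  -- On the sides of the square, the difference of the two arcs is an arc minus an endpoint, up to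
  -- sign; a sign does not change the increment.
  · refine IsLogIncrement.square
      ⟨fun x ↦ (γ i j).extend x.1 - (γ k l).extend x.2, by fun_prop⟩
      (fun x ↦ hne i j k l hij hik hil hjk hjl hkl x.1 x.2)
      (fun s ↦ ?_) (fun t ↦ ?_) (fun t ↦ ?_) (fun s ↦ ?_)
      (hθ i j k hij hik hjk) (hθ k l j hkl hjk.symm hjl.symm).neg
      (hθ k l i hkl hik.symm hil.symm).neg (hθ i j l hij hil hjl) <;> simp [f]

end Winding

/-! ### Shortest walks in plane drawings -/

namespace SimpleGraph

section Planar

variable {V : Type*} {G : SimpleGraph V}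

theorem Walk.edist_add_edist_le_of_mem_support {u v w : V} (p : G.Walk u v) (hw : w ∈ p.support) :
    G.edist u w + G.edist w v ≤ p.length := by
  classical
  have h := congrArg Walk.length (p.take_spec hw)
  rw [Walk.length_append] at h
  rw [← h, Nat.cast_add]
  exact add_le_add (edist_le _) (edist_le _)

/-- If the ball of radius `l` around `z` contains `x` but not `x'`, and the one around `z'` contains `x'`
but not `x`, then shortest walks from `z` to `x` and from `z'` to `x'` do not meet. -/
theorem Walk.notMem_support_of_edist {l : ℕ} {z z' x x' w : V} (p : G.Walk z x) (p' : G.Walk z' x')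
    (hp : p.length = G.edist z x) (hp' : p'.length = G.edist z' x')
    (hx : G.edist z x ≤ l) (hx' : G.edist z' x' ≤ l)
    (hzx' : ¬ G.edist z x' ≤ l) (hz'x : ¬ G.edist z' x ≤ l)
    (hw : w ∈ p.support) : w ∉ p'.support := by
  intro hw'
  have h1 := p.edist_add_edist_le_of_mem_support hw
  have h2 := p'.edist_add_edist_le_of_mem_support hw'
  rw [hp] at h1
  rw [hp'] at h2
  -- Exchanging the tails at `w`: the nearer of `x` and `x'` is within `l` of both centres.
  rcases le_total (G.edist w x) (G.edist w x') with h | h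
  · exact hz'x (G.edist_triangle.trans ((add_le_add_right h _).trans (h2.trans hx')))
  · exact hzx' (G.edist_triangle.trans ((add_le_add_right h _).trans (h1.trans hx)))

/-- The points of the plane covered by the drawing of the walk `p`. -/
def PlaneEmbedding.trace (E : G.PlaneEmbedding) {u v : V} (p : G.Walk u v) :
    Set (EuclideanSpace ℝ (Fin 2)) :=
  E.point '' {w | w ∈ p.support} ∪ ⋃ e : G.edgeSet, ⋃ (_ : (e : Sym2 V) ∈ p.edges), E.arc e

/-- The path need not be injective, since `exists_disjoint_edges_meet` allows arbitrary continuous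
edges. -/
theorem PlaneEmbedding.exists_path (E : G.PlaneEmbedding) {u v : V} (p : G.Walk u v) :
    ∃ γ : _root_.Path (E.point u) (E.point v), Set.range γ ⊆ E.trace p := by
  induction p with
  | nil => exact ⟨_root_.Path.refl _, by simp [trace]⟩
  | @cons u v w h p ih =>
    obtain ⟨γ, hγ⟩ := ih
    obtain ⟨δ, -, hδ⟩ := E.isPlaneArc u v h
    refine ⟨δ.trans γ, ?_⟩
    rw [_root_.Path.trans_range, hδ]
    refine Set.union_subset (fun x hx ↦ .inr ?_) (hγ.trans (Set.union_subset_union ?_ ?_))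
    · exact Set.mem_iUnion₂.2 ⟨⟨s(u, v), h⟩, by simp, hx⟩
    · exact Set.image_mono fun x hx ↦ by simp_all
    · exact Set.iUnion_mono fun e ↦ Set.iUnion_mono' fun he ↦ ⟨by simp [he], subset_rfl⟩

theorem PlaneEmbedding.disjoint_trace (E : G.PlaneEmbedding) {u v u' v' : V} (p : G.Walk u v)
    (p' : G.Walk u' v') (h : ∀ w ∈ p.support, w ∉ p'.support) :
    Disjoint (E.trace p) (E.trace p') := by
  have hmem : ∀ {a b : V} (q : G.Walk a b) {e : Sym2 V} {w : V}, e ∈ q.edges → w ∈ e →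
      w ∈ q.support := by
    intro a b q e w he hw
    induction e with
    | h c d =>
      rcases Sym2.mem_iff.1 hw with rfl | rfl
      · exact q.fst_mem_support_of_mem_edges he
      · exact q.snd_mem_support_of_mem_edges he
  rw [Set.disjoint_left]
  rintro x (⟨w, hw, rfl⟩ | hx) (⟨w', hw', hx'⟩ | hx')
  · rw [E.point_injective hx'] at hw'
    exact h w hw hw'
  · obtain ⟨e, he, hxe⟩ := Set.mem_iUnion₂.1 hx'
    exact h w hw (hmem p' he (E.mem_of_point_mem e w hxe))
  · obtain ⟨e, he, hxe⟩ := Set.mem_iUnion₂.1 hx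
    subst hx'
    exact h w' (hmem p he (E.mem_of_point_mem e w' hxe)) hw'
  · obtain ⟨e, he, hxe⟩ := Set.mem_iUnion₂.1 hx
    obtain ⟨f, hf, hxf⟩ := Set.mem_iUnion₂.1 hx'
    have hef : e ≠ f := by
      rintro rfl
      obtain ⟨w, hw⟩ : ∃ w, w ∈ (e : Sym2 V) := ⟨_, Sym2.out_fst_mem _⟩
      exact h w (hmem p he hw) (hmem p' hf hw)
    obtain ⟨w, ⟨hw, hw'⟩, -⟩ := E.inter_subset e f hef ⟨hxe, hxf⟩
    exact h w (hmem p he hw) (hmem p' hf hw')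

/-- In a planar graph, no five vertices are 2-shattered by the balls of a fixed radius. -/
theorem IsPlanar.not_pairs_fin_five (hG : G.IsPlanar) (l : ℕ) (x : Fin 5 → V) :
    ¬ ∀ a b, a ≠ b → ∃ z, ∀ h, G.edist z (x h) ≤ l ↔ h = a ∨ h = b := by
  intro H
  obtain ⟨E⟩ := hG
  have hwalk : ∀ {z y : V}, G.edist z y ≤ l → ∃ p : G.Walk z y, p.length = G.edist z y :=
    fun h ↦ exists_walk_of_edist_ne_top (ne_top_of_le_ne_top (ENat.natCast_ne_top l) h)
  -- `q i j` joins two shortest walks from a centre `z` whose ball contains `x i` and `x j` only.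
  have hq : ∀ i j, ∃ q : G.Walk (x i) (x j), i ≠ j → ∃ z,
      (∀ h, G.edist z (x h) ≤ l ↔ h = i ∨ h = j) ∧
      ∀ w ∈ q.support, ∃ h, (h = i ∨ h = j) ∧ ∃ p : G.Walk z (x h), p.length = G.edist z (x h) ∧
        w ∈ p.support := by
    have key : ∀ i j, i ≠ j → ∃ q : G.Walk (x i) (x j), ∃ z,
      (∀ h, G.edist z (x h) ≤ l ↔ h = i ∨ h = j) ∧
      ∀ w ∈ q.support, ∃ h, (h = i ∨ h = j) ∧ ∃ p : G.Walk z (x h), p.length = G.edist z (x h) ∧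
        w ∈ p.support := by
      intro i j hij
      obtain ⟨z, hz⟩ := H i j hij
      obtain ⟨p, hp⟩ := hwalk ((hz i).2 (.inl rfl))
      obtain ⟨p', hp'⟩ := hwalk ((hz j).2 (.inr rfl))
      refine ⟨p.reverse.append p', z, hz, fun w hw ↦ ?_⟩
      rcases (Walk.mem_support_append_iff _ _).1 hw with hw | hw
      · exact ⟨i, .inl rfl, p, hp, by simpa using hw⟩
      · exact ⟨j, .inr rfl, p', hp', hw⟩
    intro i j
    by_cases hij : i = j
    · subst hij; exact ⟨.nil, fun h ↦ absurd rfl h⟩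
    · obtain ⟨q, hq⟩ := key i j hij
      exact ⟨q, fun _ ↦ hq⟩
  choose q hq using hq
  choose γ hγ using fun i j ↦ E.exists_path (q i j)
  let φ : EuclideanSpace ℝ (Fin 2) ≃ₗᵢ[ℝ] ℂ := Complex.orthonormalBasisOneI.repr.symm
  obtain ⟨i, j, k, m, hnd, s, t, hst⟩ := exists_disjoint_edges_meet (fun i ↦ φ (E.point (x i)))
    (fun i j ↦ (γ i j).map φ.continuous)
  simp only [List.nodup_cons, List.mem_cons, List.not_mem_nil, or_false, not_or] at hnd
  obtain ⟨⟨hij, hik, him⟩, ⟨hjk, hjm⟩, hkm, -⟩ := hnd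
  refine Set.disjoint_left.1 (E.disjoint_trace (q i j) (q k m) fun w hw hw' ↦ ?_)
    (hγ i j ⟨s, rfl⟩) (hγ k m ⟨t, (φ.injective hst).symm⟩)
  obtain ⟨z, hz, hzq⟩ := hq i j hij
  obtain ⟨z', hz', hzq'⟩ := hq k m hkm
  obtain ⟨a, ha, p, hp, hwp⟩ := hzq w hw
  obtain ⟨b, hb, p', hp', hwp'⟩ := hzq' w hw'
  refine p.notMem_support_of_edist p' hp hp' ((hz a).2 ha) ((hz' b).2 hb) ?_ ?_ hwp hwp'
  · rw [hz]; rcases hb with rfl | rfl <;> simp [Ne.symm, *]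
  · rw [hz']; rcases ha with rfl | rfl <;> simp [*]

end Planar

end SimpleGraph

/-! ### Ramsey's theorem and the minimax theorem -/

open Finset in
/-- **Ramsey's theorem** for two colours, with the Erdős–Szekeres bound. -/
theorem exists_clique_or_independent {κ : Type*} [DecidableEq κ] (r : κ → κ → Prop)
    (hr : Std.Symm r) : ∀ (s t : ℕ) (S : Finset κ), (s + t).choose s ≤ #S →
      (∃ K ⊆ S, #K = s + 1 ∧ (K : Set κ).Pairwise r) ∨
      (∃ K ⊆ S, #K = t + 1 ∧ (K : Set κ).Pairwise fun a b ↦ ¬ r a b) := by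
  have base : ∀ S : Finset κ, 1 ≤ #S → ∃ x ∈ S, ∀ P : κ → κ → Prop,
      (({x} : Finset κ) : Set κ).Pairwise P := fun S hS ↦ by
    obtain ⟨x, hx⟩ := card_pos.1 hS
    exact ⟨x, hx, fun P ↦ by simp⟩
  have ext : ∀ (P : κ → κ → Prop), Std.Symm P → ∀ {S K : Finset κ} {x : κ} {n : ℕ}, x ∈ S →
      (∀ y ∈ K, y ∈ S.erase x ∧ P x y) → #K = n → (K : Set κ).Pairwise P →
      ∃ K ⊆ S, #K = n + 1 ∧ (K : Set κ).Pairwise P := by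
    intro P hP S K x n hx hK hn hKP
    have hxK : x ∉ K := fun h ↦ by simpa using (hK x h).1
    refine ⟨insert x K, ?_, by rw [card_insert_of_notMem hxK, hn], ?_⟩
    · exact insert_subset hx fun y hy ↦ mem_of_mem_erase (hK y hy).1
    · rw [coe_insert]
      exact (Set.pairwise_insert_of_symm_of_notMem hxK).2 ⟨hKP, fun y hy ↦ (hK y hy).2⟩
  have hr' : Std.Symm fun a b ↦ ¬ r a b := ⟨fun a b h h' ↦ h (hr.symm _ _ h')⟩
  intro s
  induction s with
  | zero =>
    intro t S hS
    obtain ⟨x, hx, hP⟩ := base S (by simpa using hS)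
    exact .inl ⟨{x}, by simpa, by simp, hP _⟩
  | succ s ihs =>
    intro t
    induction t with
    | zero =>
      intro S hS
      obtain ⟨x, hx, hP⟩ := base S (by simpa using hS)
      exact .inr ⟨{x}, by simpa, by simp, hP _⟩
    | succ t iht =>
      intro S hS
      classical
      have hch : (s + 1 + (t + 1)).choose (s + 1) =
          (s + (t + 1)).choose s + (s + 1 + t).choose (s + 1) := by
        rw [show s + 1 + (t + 1) = (s + 1 + t) + 1 by ring, Nat.choose_succ_succ,
          show s + 1 + t = s + (t + 1) by ring]
      have hpos : 0 < (s + (t + 1)).choose s := Nat.choose_pos (by omega)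
      obtain ⟨x, hx⟩ : S.Nonempty := card_pos.1 (by omega)
      have hsplit := card_filter_add_card_filter_not (s := S.erase x) (r x)
      have hcard := card_erase_add_one hx
      -- By Pascal's rule, if `x` has too few `r`-neighbours in `S`, then it has enough
      -- non-neighbours, even with `x` itself removed.
      rcases le_or_gt ((s + (t + 1)).choose s) #((S.erase x).filter (r x)) with h | h
      · rcases ihs (t + 1) _ h with ⟨K, hK, hn, hP⟩ | ⟨K, hK, hn, hP⟩
        · exact .inl (ext r hr hx (fun y hy ↦ mem_filter.1 (hK hy)) hn hP)
        · exact .inr ⟨K, hK.trans ((filter_subset _ _).trans (erase_subset _ _)), hn, hP⟩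
      · rcases iht ((S.erase x).filter fun y ↦ ¬ r x y) (by omega) with
          ⟨K, hK, hn, hP⟩ | ⟨K, hK, hn, hP⟩
        · exact .inl ⟨K, hK.trans ((filter_subset _ _).trans (erase_subset _ _)), hn, hP⟩
        · exact .inr (ext _ hr' hx (fun y hy ↦ mem_filter.1 (hK hy)) hn hP)

/-- A form of von Neumann's **minimax theorem** for matrix games. -/
theorem exists_strategy_or_exists_strategy {ι α : Type*} [Fintype ι] [Fintype α] [Nonempty ι]
    (M : ι → α → ℝ) (ε : ℝ) :
    (∃ p : α → ℝ, (∀ a, 0 ≤ p a) ∧ ∑ a, p a = 1 ∧ ∀ i, ε ≤ ∑ a, p a * M i a) ∨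
    (∃ q : ι → ℝ, (∀ i, 0 ≤ q i) ∧ ∑ i, q i = 1 ∧ ∀ a, ∑ i, q i * M i a < ε) := by
  classical
  let L : (ι → ℝ) →ₗ[ℝ] (α → ℝ) := Fintype.linearCombination ℝ M
  have hL : ∀ q a, L q a = ∑ i, q i * M i a := fun q a ↦ by
    simp [L, Fintype.linearCombination_apply, Finset.sum_apply]
  let s : Set (α → ℝ) := Set.univ.pi fun _ ↦ Set.Iio ε
  let K : Set (α → ℝ) := L '' stdSimplex ℝ ι
  -- A common point of the orthant `s` and the set `K` of mixed payoffs is a strategy `q`. Otherwise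
  -- a separating functional, normalised, is `p`: its coefficients are nonnegative because `s` is
  -- unbounded below.
  by_cases hd : Disjoint s K
  swap
  · obtain ⟨_, hs, q, hq, rfl⟩ := Set.not_disjoint_iff.1 hd
    exact .inr ⟨q, hq.1, hq.2, fun a ↦ hL q a ▸ hs a trivial⟩
  left
  obtain ⟨f, u, hfs, hfK⟩ := geometric_hahn_banach_open
    (convex_pi fun _ _ ↦ convex_Iio ε) (isOpen_set_pi Set.finite_univ fun _ _ ↦ isOpen_Iio)
    ((convex_stdSimplex ℝ ι).linear_image L) hd
  let c : α → ℝ := fun a ↦ f (Pi.single a 1)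
  have hf : ∀ x, f x = ∑ a, x a * c a := fun x ↦ by
    conv_lhs => rw [pi_eq_sum_univ' x, map_sum]
    refine Finset.sum_congr rfl fun a _ ↦ ?_
    rw [map_smul, smul_eq_mul]
  have hKi : ∀ i, u ≤ ∑ a, M i a * c a := fun i ↦ by
    have := hfK (L (Pi.single i 1)) ⟨_, single_mem_stdSimplex ℝ i, rfl⟩
    rw [hf] at this
    simpa [hL, Pi.single_apply] using this
  have hconst : ∀ δ, 0 < δ → (ε - δ) * ∑ a, c a < u := fun δ hδ ↦ by
    have := hfs (fun _ ↦ ε - δ) (fun a _ ↦ by simpa using hδ)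
    rwa [hf, ← Finset.mul_sum] at this
  have hc : ∀ a, 0 ≤ c a := by
    intro a
    by_contra! ha
    obtain ⟨t, ht0, ht⟩ : ∃ t : ℝ, 0 ≤ t ∧ u ≤ (ε - 1) * ∑ b, c b - t * c a := by
      refine ⟨max 0 ((u - (ε - 1) * ∑ b, c b) / (-c a)), le_max_left _ _, ?_⟩
      have h1 := le_max_right 0 ((u - (ε - 1) * ∑ b, c b) / (-c a))
      rw [div_le_iff₀ (by linarith)] at h1
      linarith
    have := hfs (fun b ↦ ε - 1 - t * (Pi.single a 1 : α → ℝ) b) (fun b _ ↦ by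
      have : 0 ≤ t * (Pi.single a 1 : α → ℝ) b :=
        mul_nonneg ht0 (by rw [Pi.single_apply]; split_ifs <;> norm_num)
      simp only [Set.mem_Iio]
      linarith)
    rw [hf] at this
    simp only [sub_mul _ (t * _), Finset.sum_sub_distrib, ← Finset.mul_sum, mul_assoc] at this
    simp [Pi.single_apply] at this
    linarith
  have hC : 0 < ∑ a, c a := by
    refine lt_of_le_of_ne (Finset.sum_nonneg fun a _ ↦ hc a) fun h0 ↦ ?_
    have hz := (Finset.sum_eq_zero_iff_of_nonneg fun a _ ↦ hc a).1 h0.symm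
    have h1 := hconst 1 one_pos
    obtain ⟨i⟩ := ‹Nonempty ι›
    have h2 := hKi i
    rw [Finset.sum_eq_zero fun a ha ↦ by rw [hz a ha, mul_zero]] at h2
    rw [← h0] at h1
    linarith
  have hu : ε * ∑ a, c a ≤ u := by
    by_contra! h
    have := hconst ((ε * ∑ a, c a - u) / ∑ a, c a) (div_pos (by linarith) hC)
    rw [sub_mul, div_mul_cancel₀ _ hC.ne'] at this
    linarith
  refine ⟨fun a ↦ c a / ∑ b, c b, fun a ↦ div_nonneg (hc a) hC.le, ?_, fun i ↦ ?_⟩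
  · rw [← Finset.sum_div, div_self hC.ne']
  · have : ∑ a, c a / (∑ b, c b) * M i a = (∑ a, M i a * c a) / ∑ b, c b := by
      rw [Finset.sum_div]
      exact Finset.sum_congr rfl fun a _ ↦ by ring
    rw [this, le_div_iff₀ hC]
    exact hu.trans (hKi i)

/-! ### Random sampling of sets -/

section Sampling

open Finset

variable {ι α : Type*}

/-- Every two of the sets `B (g a)` share a point that lies in none of the others. -/
def PairShattered (B : ι → Finset α) {n : ℕ} (g : Fin n → ι) : Prop :=
  ∀ a b, a ≠ b → ∃ v, ∀ h, v ∈ B (g h) ↔ h = a ∨ h = b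

/-- If `g a = g b`, a point shared by `g a` and a third `g c` also lies in `g b`. For `n = 2` a
constant `g` can be pair-shattered. -/
theorem PairShattered.injective {B : ι → Finset α} {n : ℕ} {g : Fin n → ι}
    (hg : PairShattered B g) (hn : 3 ≤ n) : Function.Injective g := by
  intro a b hab
  by_contra hne
  obtain ⟨c, hc⟩ : ∃ c, c ∉ ({a, b} : Finset (Fin n)) := by
    by_contra! h
    have := card_le_card (show (univ : Finset (Fin n)) ⊆ {a, b} from fun x _ ↦ h x)
    have := card_le_two (a := a) (b := b)
    simp only [card_univ, Fintype.card_fin] at *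
    omega
  simp only [mem_insert, mem_singleton, not_or] at hc
  obtain ⟨v, hv⟩ := hg a c (Ne.symm hc.1)
  have := (hv b).1 (hab ▸ (hv a).2 (.inl rfl))
  rcases this with h | h
  · exact hne h.symm
  · exact hc.2 h.symm

/-- In a sequence of independent samples, every event that depends on three of them has at most its
largest conditional probability given two of them. -/
theorem sum_prod_mul_indicator_le [Fintype ι] {n : ℕ} (q : ι → ℝ) (hq0 : ∀ i, 0 ≤ q i)
    (hq1 : ∑ i, q i = 1) {ε : ℝ} (P : ι → ι → ι → Prop) [∀ a b c, Decidable (P a b c)]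
    (hP : ∀ a b, ∑ c, q c * (if P a b c then 1 else 0) ≤ ε)
    (i j h : Fin n) (hi : i ≠ h) (hj : j ≠ h) :
    ∑ f : Fin n → ι, (∏ k, q (f k)) * (if P (f i) (f j) (f h) then 1 else 0) ≤ ε := by
  obtain _ | n := n
  · exact i.elim0
  obtain ⟨i, rfl⟩ := Fin.exists_succAbove_eq hi
  obtain ⟨j, rfl⟩ := Fin.exists_succAbove_eq hj
  -- Sample `h` is averaged first, with all others, including `i` and `j`, fixed.
  rw [← (Fin.insertNthEquiv (fun _ ↦ ι) h).sum_comp, Fintype.sum_prod_type, sum_comm]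
  simp only [Fin.insertNthEquiv_apply, Fin.insertNth_apply_same, Fin.insertNth_apply_succAbove,
    Fin.prod_univ_succAbove _ h]
  calc ∑ g : Fin n → ι, ∑ c, q c * (∏ k, q (g k)) * (if P (g i) (g j) c then (1 : ℝ) else 0)
      = ∑ g : Fin n → ι, (∏ k, q (g k)) * ∑ c, q c * (if P (g i) (g j) c then (1 : ℝ) else 0) := by
        refine sum_congr rfl fun g _ ↦ ?_
        rw [mul_sum]
        exact sum_congr rfl fun c _ ↦ by ring
    _ ≤ ∑ g : Fin n → ι, (∏ k, q (g k)) * ε :=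
        sum_le_sum fun g _ ↦ mul_le_mul_of_nonneg_left (hP _ _) (prod_nonneg fun k _ ↦ hq0 _)
    _ = ε := by
        rw [← sum_mul, ← Fintype.sum_pow, hq1, one_pow, one_mul]

theorem two_mul_card_filter_lt_le (n : ℕ) :
    2 * #{x : Fin n × Fin n | x.1 < x.2} ≤ n ^ 2 := by
  have h1 : #{x : Fin n × Fin n | x.2 < x.1} = #{x : Fin n × Fin n | x.1 < x.2} :=
    card_bij (fun x _ ↦ x.swap) (by simp) (by simp [Prod.ext_iff]; tauto)
      fun x hx ↦ ⟨x.swap, by simpa using hx, by simp⟩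
  have h2 : Disjoint (univ.filter fun x : Fin n × Fin n ↦ x.1 < x.2)
      (univ.filter fun x : Fin n × Fin n ↦ x.2 < x.1) := by
    rw [disjoint_filter]
    exact fun x _ h ↦ h.le.not_gt
  have h3 := card_le_univ ((univ.filter fun x : Fin n × Fin n ↦ x.1 < x.2) ∪
    univ.filter fun x : Fin n × Fin n ↦ x.2 < x.1)
  rw [card_union_of_disjoint h2, h1, Fintype.card_prod, Fintype.card_fin] at h3
  nlinarith

/-- If the sets `B i` have a fractional packing of large value, then they contain many disjoint sets
or a large family in which every two sets have a common point of their own. -/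
theorem exists_pairShattered_of_weights [Fintype ι] [DecidableEq α]
    (B : ι → Finset α) (hB : ∀ i, (B i).Nonempty) {d ν : ℕ}
    (hν : ∀ S : Finset ι, (S : Set ι).PairwiseDisjoint B → #S ≤ ν)
    (q : ι → ℝ) (hq0 : ∀ i, 0 ≤ q i) (hq1 : ∑ i, q i = 1)
    (hq : ∀ a, ∑ i, q i * (if a ∈ B i then 1 else 0) ≤ 1 / (4 * ((d + ν).choose d : ℝ) ^ 2)) :
    ∃ g : Fin (d + 1) → ι, PairShattered B g := by
  classical
  set R := (d + ν).choose d with hR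
  have hRpos : 0 < R := Nat.choose_pos (by omega)
  obtain ⟨i₀⟩ : Nonempty ι := by
    by_contra h
    rw [not_nonempty_iff] at h
    simp at hq1
  -- For disjoint sets the point is arbitrary; the expectation bound holds for every point.
  have hv : ∀ i j, ∃ v, (B i ∩ B j).Nonempty → v ∈ B i ∩ B j := fun i j ↦ by
    by_cases h : (B i ∩ B j).Nonempty
    · exact ⟨h.choose, fun _ ↦ h.choose_spec⟩
    · exact ⟨(hB i₀).choose, fun h' ↦ absurd h' h⟩
  choose v hv using hv
  let T : Finset ((Fin (2 * R) × Fin (2 * R)) × Fin (2 * R)) :=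
    {x | x.1.1 < x.1.2 ∧ x.1.1 ≠ x.2 ∧ x.1.2 ≠ x.2}
  have hT : (#T : ℝ) ≤ 4 * (R : ℝ) ^ 3 := by
    have h1 : T ⊆ (univ.filter fun x : Fin (2 * R) × Fin (2 * R) ↦ x.1 < x.2) ×ˢ univ := fun x hx ↦ by
      simp only [T, mem_filter] at hx
      simp [hx]
    have h2 := card_le_card h1
    have h3 := two_mul_card_filter_lt_le (2 * R)
    rw [card_product, card_univ, Fintype.card_fin] at h2
    have : #T ≤ 4 * R ^ 3 := by nlinarith
    exact_mod_cast this
  let bad : (Fin (2 * R) → ι) → Finset ((Fin (2 * R) × Fin (2 * R)) × Fin (2 * R)) := fun f ↦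
    {x ∈ T | v (f x.1.1) (f x.1.2) ∈ B (f x.2)}
  -- The expected number of bad triples is at most `4R³ · 1 / (4R²) = R`.
  obtain ⟨f, hf⟩ : ∃ f, #(bad f) ≤ R := by
    by_contra! H
    have h1 : ∑ f : Fin (2 * R) → ι, (∏ k, q (f k)) * (#(bad f) : ℝ) ≤ R := by
      calc ∑ f : Fin (2 * R) → ι, (∏ k, q (f k)) * (#(bad f) : ℝ)
          = ∑ x ∈ T, ∑ f : Fin (2 * R) → ι, (∏ k, q (f k)) *
              (if v (f x.1.1) (f x.1.2) ∈ B (f x.2) then 1 else 0) := by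
            rw [sum_comm]
            refine sum_congr rfl fun f _ ↦ ?_
            rw [← mul_sum, sum_boole]
        _ ≤ ∑ x ∈ T, 1 / (4 * (R : ℝ) ^ 2) := sum_le_sum fun x hx ↦ by
            simp only [T, mem_filter] at hx
            exact sum_prod_mul_indicator_le q hq0 hq1 (fun a b c ↦ v a b ∈ B c)
              (fun a b ↦ hq _) _ _ _ hx.2.2.1 hx.2.2.2
        _ = #T * (1 / (4 * (R : ℝ) ^ 2)) := by rw [sum_const, nsmul_eq_mul]
        _ ≤ 4 * (R : ℝ) ^ 3 * (1 / (4 * (R : ℝ) ^ 2)) := by gcongr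
        _ = R := by
            have : (R : ℝ) ≠ 0 := by positivity
            field_simp
    have h2 : ∑ f : Fin (2 * R) → ι, (∏ k, q (f k)) * ((R : ℝ) + 1) ≤
        ∑ f : Fin (2 * R) → ι, (∏ k, q (f k)) * (#(bad f) : ℝ) :=
      sum_le_sum fun f _ ↦ mul_le_mul_of_nonneg_left (by exact_mod_cast H f)
        (prod_nonneg fun k _ ↦ hq0 _)
    rw [← sum_mul, ← Fintype.sum_pow, hq1, one_pow, one_mul] at h2
    linarith
  let S : Finset (Fin (2 * R)) := univ \ (bad f).image Prod.snd
  have hS : R ≤ #S := by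
    have h1 := le_card_sdiff ((bad f).image Prod.snd) (univ : Finset (Fin (2 * R)))
    have h2 : #((bad f).image Prod.snd) ≤ #(bad f) := card_image_le
    rw [card_univ, Fintype.card_fin] at h1
    have h3 : #(univ \ (bad f).image Prod.snd) = #S := rfl
    omega
  have hgood : ∀ i j h, h ∈ S → i < j → i ≠ h → j ≠ h → v (f i) (f j) ∉ B (f h) := by
    intro i j h hh hij hih hjh hmem
    refine (mem_sdiff.1 hh).2 (mem_image.2 ⟨((i, j), h), ?_, rfl⟩)
    simp [bad, T, hij, hih, hjh, hmem]
  rcases exists_clique_or_independent (fun i j ↦ (B (f i) ∩ B (f j)).Nonempty)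
    ⟨fun i j h ↦ by rwa [inter_comm]⟩ d ν S hS with ⟨K, hKS, hK, hKr⟩ | ⟨K, hKS, hK, hKr⟩
  · let e := K.orderEmbOfFin hK
    have heK : ∀ a, e a ∈ K := K.orderEmbOfFin_mem hK
    have key : ∀ a b, a < b → ∀ h, v (f (e a)) (f (e b)) ∈ B (f (e h)) ↔ h = a ∨ h = b := by
      intro a b hab h
      have hm := hv _ _ (hKr (heK a) (heK b) (e.injective.ne hab.ne))
      constructor
      · intro hmem
        by_contra! hne
        exact hgood _ _ _ (hKS (heK h)) (e.strictMono hab) (e.injective.ne hne.1.symm)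
          (e.injective.ne hne.2.symm) hmem
      · rintro (rfl | rfl)
        · exact (mem_inter.1 hm).1
        · exact (mem_inter.1 hm).2
    refine ⟨fun a ↦ f (e a), fun a b hab ↦ ?_⟩
    rcases lt_or_gt_of_ne hab with h | h
    · exact ⟨_, key a b h⟩
    · exact ⟨_, fun c ↦ (key b a h c).trans or_comm⟩
  · have hdis : ∀ i ∈ K, ∀ j ∈ K, i ≠ j → Disjoint (B (f i)) (B (f j)) := fun i hi j hj hij ↦ by
      have : ¬ (B (f i) ∩ B (f j)).Nonempty := hKr hi hj hij
      rwa [not_nonempty_iff_eq_empty, ← disjoint_iff_inter_eq_empty] at this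
    have hinj : Set.InjOn f K := by
      intro i hi j hj hij
      by_contra hne
      have := hdis i hi j hj hne
      rw [hij, disjoint_self_iff_empty] at this
      exact (hB _).ne_empty this
    have := hν (K.image f) (by
      intro a ha b hb hab
      obtain ⟨i, hi, rfl⟩ := mem_image.1 ha
      obtain ⟨j, hj, rfl⟩ := mem_image.1 hb
      exact hdis i hi j hj (ne_of_apply_ne f hab))
    rw [card_image_of_injOn hinj] at this
    omega

end Sampling

/-! ### The ε-net theorem -/

section EpsilonNet

open Finset

variable {ι α : Type*}

theorem sum_range_choose_le_pow (n D : ℕ) : ∑ k ∈ range (D + 1), n.choose k ≤ (n + 1) ^ D := by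
  rw [add_pow]
  refine sum_le_sum fun k hk ↦ ?_
  have h1 : 1 ≤ D.choose k := Nat.choose_pos (by simpa [Nat.lt_succ_iff] using hk)
  calc n.choose k ≤ n ^ k := Nat.choose_le_pow n k
    _ ≤ n ^ k * 1 ^ (D - k) * D.choose k := by simpa using Nat.le_mul_of_pos_right _ h1

/-- The Sauer–Shelah bound for the traces of a set system on a sequence of points. -/
theorem card_image_trace_le [Fintype ι] [DecidableEq α] {β : Type*} [Fintype β] [DecidableEq β]
    (B : ι → Finset α) {D : ℕ}
    (hD : ∀ S : Finset α, (∀ T ⊆ S, ∃ i, S ∩ B i = T) → #S ≤ D) (z : β → α) :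
    #(univ.image fun i ↦ univ.filter fun b ↦ z b ∈ B i) ≤ (Fintype.card β + 1) ^ D := by
  set 𝒜 := univ.image fun i ↦ univ.filter fun b ↦ z b ∈ B i with h𝒜
  have hmem : ∀ u ∈ 𝒜, ∃ i, ∀ b, b ∈ u ↔ z b ∈ B i := fun u hu ↦ by
    obtain ⟨i, -, rfl⟩ := mem_image.1 hu
    exact ⟨i, by simp⟩
  have hvc : 𝒜.vcDim ≤ D := by
    refine Finset.sup_le fun S hS ↦ ?_
    have hS := mem_shatterer.1 hS
    -- The sequence may repeat points, but no trace separates two indices of the same point.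
    have hinj : Set.InjOn z S := by
      intro b hb b' hb' hbb'
      obtain ⟨u, hu, hSu⟩ := hS (singleton_subset_iff.2 hb)
      obtain ⟨i, hi⟩ := hmem u hu
      have h1 : b ∈ u := (mem_inter.1 (hSu ▸ mem_singleton_self b : b ∈ S ∩ u)).2
      have h2 : b' ∈ S ∩ u := mem_inter.2 ⟨hb', (hi b').2 (hbb' ▸ (hi b).1 h1)⟩
      rw [hSu, mem_singleton] at h2
      exact h2.symm
    rw [← card_image_of_injOn hinj]
    refine hD _ fun T hT ↦ ?_
    obtain ⟨u, hu, hSu⟩ := hS (filter_subset (fun b ↦ z b ∈ T) S)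
    obtain ⟨i, hi⟩ := hmem u hu
    refine ⟨i, ?_⟩
    have key : ∀ b ∈ S, z b ∈ B i ↔ z b ∈ T := fun b hb ↦ by
      have := congrArg (b ∈ ·) hSu
      simpa [hb, hi] using this
    ext y
    rw [mem_inter, mem_image]
    constructor
    · rintro ⟨⟨b, hb, rfl⟩, hy⟩
      exact (key b hb).1 hy
    · intro hy
      obtain ⟨b, hb, rfl⟩ := mem_image.1 (hT hy)
      exact ⟨⟨b, hb, rfl⟩, (key b hb).2 hy⟩
  calc #𝒜 ≤ #𝒜.shatterer := card_le_card_shatterer 𝒜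
    _ ≤ ∑ k ∈ Iic 𝒜.vcDim, (Fintype.card β).choose k := card_shatterer_le_sum_vcDim
    _ ≤ ∑ k ∈ range (D + 1), (Fintype.card β).choose k :=
        sum_le_sum_of_subset fun k hk ↦ by
          rw [mem_Iic] at hk
          rw [mem_range]
          omega
    _ ≤ _ := sum_range_choose_le_pow _ _

/-- Few ways of swapping the two elements in `m` pairs avoid a given set on one side while many
elements of the set lie on the other side. -/
theorem card_swaps_mul_two_pow_le {m : ℕ} (T : Finset (Fin m × Bool)) (k : ℕ) :
    #{σ : Fin m → Bool | (∀ t, (t, σ t) ∉ T) ∧ k ≤ #{t | (t, !σ t) ∈ T}} * 2 ^ k ≤ 2 ^ m := by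
  set F := univ.filter fun σ : Fin m → Bool ↦ (∀ t, (t, σ t) ∉ T) ∧ k ≤ #{t | (t, !σ t) ∈ T}
    with hF
  obtain hF0 | ⟨σ₀, hσ₀⟩ := F.eq_empty_or_nonempty
  · simp [hF0]
  obtain ⟨-, h0, hk⟩ := mem_filter.1 hσ₀
  -- Every admissible `σ` agrees with `σ₀` on `P`: a swap there would select an element of `T`. At
  -- most `m - k` choices stay free.
  set P : Finset (Fin m) := {t | (t, !σ₀ t) ∈ T} with hP
  have hsub : F ⊆ Fintype.piFinset fun t ↦ if t ∈ P then {σ₀ t} else univ := by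
    intro σ hσ
    obtain ⟨-, h, -⟩ := mem_filter.1 hσ
    refine Fintype.mem_piFinset.2 fun t ↦ ?_
    split_ifs with ht
    · rw [mem_singleton]
      by_contra hne
      have : σ t = !σ₀ t := by cases h1 : σ t <;> cases h2 : σ₀ t <;> simp_all
      exact h t (this ▸ (mem_filter.1 ht).2)
    · exact mem_univ _
  have hcard := card_le_card hsub
  rw [Fintype.card_piFinset] at hcard
  have hprod : ∏ t : Fin m, #(if t ∈ P then {σ₀ t} else (univ : Finset Bool)) = 2 ^ #Pᶜ := by
    rw [← prod_const, ← prod_subset (subset_univ Pᶜ)]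
    · refine prod_congr rfl fun t ht ↦ ?_
      rw [if_neg (by simpa using ht)]
      rfl
    · intro t _ ht
      rw [if_pos (by simpa using ht), card_singleton]
  rw [hprod] at hcard
  calc #F * 2 ^ k ≤ 2 ^ #Pᶜ * 2 ^ #P := Nat.mul_le_mul hcard (Nat.pow_le_pow_right two_pos hk)
    _ = 2 ^ m := by rw [← pow_add, card_compl_add_card, Fintype.card_fin]

/-- An exponential bound for the lower tail of the number of samples that hit a set. -/
theorem sum_prod_mul_tail_le [Fintype α] [DecidableEq α] (p : α → ℝ) (hp0 : ∀ a, 0 ≤ p a)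
    (hp1 : ∑ a, p a = 1) {ε : ℝ} (A : Finset α) (hA : ε ≤ ∑ a, p a * (if a ∈ A then 1 else 0))
    {m k : ℕ} (hk : (2 : ℝ) ^ k ≤ Real.exp (ε * m / 2)) :
    ∑ y : Fin m → α, (∏ t, p (y t)) * (if #{t | y t ∈ A} < k then 1 else 0) ≤ 1 / 2 := by
  -- Each hit contributes a factor `1 / 2`, so having at most `k - 1` hits costs at most `2 ^ (k -
  -- 1)`.
  let c : α → ℝ := fun a ↦ if a ∈ A then 1 / 2 else 1
  have hc0 : ∀ a, 0 ≤ c a := fun a ↦ by simp only [c]; split_ifs <;> norm_num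
  have hind : ∀ y : Fin m → α, (if #{t | y t ∈ A} < k then (1 : ℝ) else 0) ≤
      2 ^ k / 2 * ∏ t, c (y t) := by
    intro y
    have hprod : ∏ t, c (y t) = (1 / 2) ^ #{t | y t ∈ A} := by
      simp only [c]
      rw [prod_ite, prod_const, prod_const_one, mul_one]
    split_ifs with h
    · obtain ⟨j, rfl⟩ := Nat.exists_eq_add_of_lt h
      rw [hprod, one_div, inv_pow, pow_succ, pow_add]
      have h1 : (1 : ℝ) ≤ 2 ^ j := one_le_pow₀ (by norm_num)
      field_simp
      exact h1
    · exact mul_nonneg (by positivity) (prod_nonneg fun t _ ↦ hc0 _)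
  have hsum : ∑ a, p a * c a ≤ Real.exp (-(ε / 2)) := by
    have : ∑ a, p a * c a = 1 - (∑ a, p a * (if a ∈ A then 1 else 0)) / 2 := by
      rw [sum_div, eq_sub_iff_add_eq, ← sum_add_distrib]
      refine (sum_congr rfl fun a _ ↦ ?_).trans hp1
      simp only [c]
      split_ifs <;> ring
    rw [this]
    have := Real.add_one_le_exp (-(ε / 2))
    linarith
  calc ∑ y : Fin m → α, (∏ t, p (y t)) * (if #{t | y t ∈ A} < k then (1 : ℝ) else 0)
      ≤ ∑ y : Fin m → α, (∏ t, p (y t)) * (2 ^ k / 2 * ∏ t, c (y t)) :=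
        sum_le_sum fun y _ ↦ mul_le_mul_of_nonneg_left (hind y) (prod_nonneg fun t _ ↦ hp0 _)
    _ = 2 ^ k / 2 * (∑ a, p a * c a) ^ m := by
        rw [Fintype.sum_pow, mul_sum]
        exact sum_congr rfl fun y _ ↦ by rw [prod_mul_distrib]; ring
    _ ≤ 2 ^ k / 2 * Real.exp (-(ε / 2)) ^ m := by
        have : 0 ≤ ∑ a, p a * c a := sum_nonneg fun a _ ↦ mul_nonneg (hp0 a) (hc0 a)
        gcongr
    _ ≤ Real.exp (ε * m / 2) / 2 * Real.exp (-(ε / 2)) ^ m := by gcongr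
    _ = 1 / 2 := by
        rw [← Real.exp_nat_mul, div_mul_eq_mul_div, ← Real.exp_add]
        rw [show ε * m / 2 + m * -(ε / 2) = 0 by ring, Real.exp_zero]

/-- The **ε-net theorem** of Haussler and Welzl: a set system of bounded Vapnik–Chervonenkis
dimension in which every set has weight at least `ε` has a small hitting set. -/
theorem exists_hitting_of_weights [Fintype ι] [Fintype α] [DecidableEq α] (B : ι → Finset α)
    {D : ℕ} (hD : ∀ S : Finset α, (∀ T ⊆ S, ∃ i, S ∩ B i = T) → #S ≤ D)
    (p : α → ℝ) (hp0 : ∀ a, 0 ≤ p a) (hp1 : ∑ a, p a = 1) {ε : ℝ}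
    (hε : ∀ i, ε ≤ ∑ a, p a * (if a ∈ B i then 1 else 0)) {m k : ℕ}
    (hk : (2 : ℝ) ^ k ≤ Real.exp (ε * m / 2)) (hm : 2 * (2 * m + 1) ^ D < 2 ^ k) :
    ∃ X : Finset α, #X ≤ m ∧ ∀ i, ∃ a ∈ X, a ∈ B i := by
  classical
  by_contra! H
  have hx : ∀ x : Fin m → α, ∃ i, ∀ t, x t ∉ B i := by
    intro x
    obtain ⟨i, hi⟩ := H (univ.image x) (by simpa using card_image_le (s := univ) (f := x))
    exact ⟨i, fun t ↦ hi _ (mem_image_of_mem x (mem_univ t))⟩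
  choose e he using hx
  let W : (Fin m → Bool → α) → ℝ := fun z ↦ ∏ t, (p (z t false) * p (z t true))
  have hW0 : ∀ z, 0 ≤ W z := fun z ↦ prod_nonneg fun t _ ↦ mul_nonneg (hp0 _) (hp0 _)
  -- Double sampling: the first sample misses some set that the second hits at least `k` times. If
  -- every sample misses a set, `Q` has probability at least `1 / 2`.
  let Q : (Fin m → Bool → α) → Prop := fun z ↦
    ∃ i, (∀ t, z t false ∉ B i) ∧ k ≤ #{t | z t true ∈ B i}
  let φ : (Fin m → α) × (Fin m → α) ≃ (Fin m → Bool → α) :=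
    { toFun := fun xy t b ↦ cond b (xy.2 t) (xy.1 t)
      invFun := fun z ↦ (fun t ↦ z t false, fun t ↦ z t true)
      left_inv := fun _ ↦ rfl
      right_inv := fun z ↦ by ext t b; cases b <;> rfl }
  have hWφ : ∀ x y, W (φ (x, y)) = (∏ t, p (x t)) * ∏ t, p (y t) := fun x y ↦ prod_mul_distrib
  have hprob : ∑ x : Fin m → α, ∏ t, p (x t) = 1 := by
    rw [← Fintype.sum_pow, hp1, one_pow]
  have hW1 : ∑ z, W z = 1 := by
    rw [← φ.sum_comp, Fintype.sum_prod_type]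
    simp only [hWφ, ← mul_sum, hprob, mul_one]
  have hlow : 1 / 2 ≤ ∑ z, W z * (if Q z then 1 else 0) := by
    rw [← φ.sum_comp, Fintype.sum_prod_type]
    calc (1 / 2 : ℝ) = ∑ x : Fin m → α, (∏ t, p (x t)) * (1 / 2) := by
          rw [← sum_mul, hprob, one_mul]
      _ ≤ ∑ x : Fin m → α, (∏ t, p (x t)) * ∑ y : Fin m → α, (∏ t, p (y t)) *
            (if Q (φ (x, y)) then 1 else 0) := by
          refine sum_le_sum fun x _ ↦ mul_le_mul_of_nonneg_left ?_ (prod_nonneg fun t _ ↦ hp0 _)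
          have h1 := sum_prod_mul_tail_le p hp0 hp1 (B (e x)) (hε _) hk
          have h2 : ∀ y : Fin m → α, (∏ t, p (y t)) -
              (∏ t, p (y t)) * (if #{t | y t ∈ B (e x)} < k then 1 else 0) ≤
              (∏ t, p (y t)) * (if Q (φ (x, y)) then 1 else 0) := by
            intro y
            have h3 : 0 ≤ ∏ t, p (y t) := prod_nonneg fun t _ ↦ hp0 _
            by_cases hy : #{t | y t ∈ B (e x)} < k
            · rw [if_pos hy, mul_one, sub_self]
              exact mul_nonneg h3 (by split_ifs <;> norm_num)
            · rw [if_neg hy, if_pos ⟨e x, he x, not_lt.1 hy⟩]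
              simp
          have h3 := sum_le_sum fun y (_ : y ∈ univ) ↦ h2 y
          rw [sum_sub_distrib, hprob] at h3
          linarith
      _ = _ := by
          refine sum_congr rfl fun x _ ↦ ?_
          rw [mul_sum]
          exact sum_congr rfl fun y _ ↦ by rw [hWφ, mul_assoc]
  -- Swapping within pairs preserves the weight, so `Q` may be averaged over `σ` for fixed `z`,
  -- where only `(2m + 1) ^ D` traces matter.
  let act : (Fin m → Bool) → (Fin m → Bool → α) → (Fin m → Bool → α) :=
    fun σ z t b ↦ z t (xor b (σ t))
  have hact : ∀ σ, Function.Involutive (act σ) := fun σ z ↦ by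
    ext t b
    simp [act]
  have hWact : ∀ σ z, W (act σ z) = W z := fun σ z ↦ by
    refine prod_congr rfl fun t _ ↦ ?_
    cases h : σ t <;> simp [act, h, mul_comm]
  have hcount : ∀ z, #{σ | Q (act σ z)} * 2 ^ k ≤ (2 * m + 1) ^ D * 2 ^ m := by
    intro z
    let 𝒜 : Finset (Finset (Fin m × Bool)) := univ.image fun i ↦ univ.filter fun x ↦ z x.1 x.2 ∈ B i
    have h𝒜 : #𝒜 ≤ (2 * m + 1) ^ D := by
      have := card_image_trace_le B hD fun x : Fin m × Bool ↦ z x.1 x.2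
      simpa [mul_comm] using this
    let F : Finset (Fin m × Bool) → Finset (Fin m → Bool) := fun T ↦
      {σ | (∀ t, (t, σ t) ∉ T) ∧ k ≤ #{t | (t, !σ t) ∈ T}}
    have hsub : ({σ | Q (act σ z)} : Finset (Fin m → Bool)) ⊆ 𝒜.biUnion F := by
      intro σ hσ
      obtain ⟨i, hi1, hi2⟩ := (mem_filter.1 hσ).2
      refine mem_biUnion.2 ⟨_, mem_image_of_mem _ (mem_univ i), mem_filter.2 ⟨mem_univ _, ?_, ?_⟩⟩
      · intro t
        simpa [act] using hi1 t
      · simpa [act] using hi2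
    calc #{σ | Q (act σ z)} * 2 ^ k ≤ (∑ T ∈ 𝒜, #(F T)) * 2 ^ k :=
          Nat.mul_le_mul_right _ ((card_le_card hsub).trans card_biUnion_le)
      _ = ∑ T ∈ 𝒜, #(F T) * 2 ^ k := sum_mul _ _ _
      _ ≤ ∑ T ∈ 𝒜, 2 ^ m := sum_le_sum fun T _ ↦ card_swaps_mul_two_pow_le T k
      _ = #𝒜 * 2 ^ m := by rw [sum_const, smul_eq_mul]
      _ ≤ _ := Nat.mul_le_mul_right _ h𝒜
  have hsym : (2 : ℝ) ^ m * ∑ z, W z * (if Q z then 1 else 0) = ∑ z, W z * #{σ | Q (act σ z)} := by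
    calc (2 : ℝ) ^ m * ∑ z, W z * (if Q z then (1 : ℝ) else 0)
        = ∑ σ : Fin m → Bool, ∑ z, W z * (if Q z then (1 : ℝ) else 0) := by
          simp [sum_const, nsmul_eq_mul]
      _ = ∑ σ : Fin m → Bool, ∑ z, W z * (if Q (act σ z) then (1 : ℝ) else 0) := by
          refine sum_congr rfl fun σ _ ↦ ?_
          rw [← Equiv.sum_comp (hact σ).toPerm]
          exact sum_congr rfl fun z _ ↦ by simp only [Function.Involutive.coe_toPerm, hWact]; congr
      _ = _ := by
          rw [sum_comm]
          refine sum_congr rfl fun z _ ↦ ?_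
          rw [← mul_sum, sum_boole]
  have hupp : (∑ z, W z * (#{σ | Q (act σ z)} : ℝ)) * 2 ^ k ≤ (2 * m + 1 : ℝ) ^ D * 2 ^ m := by
    calc (∑ z, W z * (#{σ | Q (act σ z)} : ℝ)) * 2 ^ k
        = ∑ z, W z * ((#{σ | Q (act σ z)} : ℝ) * 2 ^ k) := by
          rw [sum_mul]
          exact sum_congr rfl fun z _ ↦ mul_assoc _ _ _
      _ ≤ ∑ z, W z * ((2 * m + 1 : ℝ) ^ D * 2 ^ m) :=
          sum_le_sum fun z _ ↦ mul_le_mul_of_nonneg_left (by exact_mod_cast hcount z) (hW0 z)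
      _ = _ := by rw [← sum_mul, hW1, one_mul]
  rw [← hsym] at hupp
  have hm' : 2 * (2 * m + 1 : ℝ) ^ D < 2 ^ k := by exact_mod_cast hm
  have h2m : (0 : ℝ) < 2 ^ m := by positivity
  have h2k : (0 : ℝ) < 2 ^ k := by positivity
  have h1 : (2 : ℝ) ^ m * (1 / 2) * 2 ^ k ≤ (2 * m + 1 : ℝ) ^ D * 2 ^ m :=
    le_trans (by gcongr) hupp
  have h2 : (2 : ℝ) ^ m * (1 / 2) * 2 ^ k = (2 ^ k / 2) * 2 ^ m := by ring
  rw [h2] at h1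
  have := le_of_mul_le_mul_right h1 h2m
  linarith

end EpsilonNet

/-! ### Hitting sets for families without pair-shattered members -/

section HittingSet

open Finset

variable {ι α : Type*}

/-- A shattered set of `(d + 1).choose 2` points yields `d + 1` sets in which every two have a common
point of their own. -/
theorem card_le_of_no_pairShattered [DecidableEq α] (B : ι → Finset α) {d : ℕ}
    (hB : ∀ g : Fin (d + 1) → ι, ¬ PairShattered B g) (S : Finset α)
    (hS : ∀ T ⊆ S, ∃ i, S ∩ B i = T) : #S ≤ (d + 1).choose 2 - 1 := by
  by_contra! hlt
  let P := (univ : Finset (Fin (d + 1))).powersetCard 2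
  have hcard : Fintype.card P ≤ Fintype.card S := by
    rw [Fintype.card_coe, Fintype.card_coe, card_powersetCard, card_univ, Fintype.card_fin]
    omega
  obtain ⟨φ⟩ := Function.Embedding.nonempty_of_card_le hcard
  -- Points of `S` are labelled by pairs, and `g a` picks out the labels containing `a`.
  have hT : ∀ a : Fin (d + 1), ∃ i, S ∩ B i = ({x : P | a ∈ x.1} : Finset P).image
      (fun x ↦ (φ x : α)) := fun a ↦ hS _ fun y hy ↦ by
    obtain ⟨x, -, rfl⟩ := mem_image.1 hy
    exact (φ x).2
  choose g hg using hT
  refine hB g fun a b hab ↦ ?_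
  have hp : ({a, b} : Finset (Fin (d + 1))) ∈ P :=
    mem_powersetCard.2 ⟨subset_univ _, card_pair hab⟩
  refine ⟨φ ⟨_, hp⟩, fun h ↦ ?_⟩
  have h1 : (φ ⟨_, hp⟩ : α) ∈ B (g h) ↔ (φ ⟨_, hp⟩ : α) ∈ S ∩ B (g h) := by simp
  rw [h1, hg, mem_image]
  constructor
  · rintro ⟨x, hx, hxφ⟩
    have := φ.injective (Subtype.ext hxφ)
    subst this
    simpa using hx
  · intro h
    exact ⟨⟨_, hp⟩, by simpa using h, rfl⟩

theorem choose_mul_two_le_two_pow {n k : ℕ} (hk : k ≠ 0) (hn : n ≠ 0) :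
    2 * n.choose k ≤ 2 ^ n := by
  obtain ⟨n, rfl⟩ := Nat.exists_eq_succ_of_ne_zero hn
  obtain ⟨k, rfl⟩ := Nat.exists_eq_succ_of_ne_zero hk
  have h : ∑ i ∈ {k, k + 1}, n.choose i ≤ ∑ i ∈ range (n + 2), n.choose i := by
    by_cases hkn : k + 1 ≤ n + 1
    · refine sum_le_sum_of_subset fun i hi ↦ ?_
      simp only [mem_insert, mem_singleton] at hi
      rw [mem_range]
      omega
    · rw [sum_pair (by simp), Nat.choose_eq_zero_of_lt (by omega),
        Nat.choose_eq_zero_of_lt (by omega)]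
      simp
  rw [sum_pair (by simp), sum_range_succ, Nat.choose_eq_zero_of_lt (Nat.lt_succ_self n),
    Nat.sum_range_choose] at h
  rw [Nat.succ_eq_add_one, Nat.choose_succ_succ, pow_succ]
  simp only [Nat.succ_eq_add_one] at *
  omega

/-- This fixes the constant `11`. With `u = d + ν + 3`, it suffices that `2 * (2 * m + 1) ≤ exp (22
/ 9 * u)`, since `9 / 16 * (22 / 9) = 11 / 8`. The left side is at most `45 / 256 * u ^ 3 * 4 ^ u`,
and `22 / 9` exceeds `log 4` by at least `1.05`. -/
theorem four_mul_pow_le_exp {d ν R D : ℕ} (hd : 2 ≤ d) (hν : 1 ≤ ν) (hR : 1 ≤ R)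
    (hR' : 2 * R ≤ 2 ^ (d + ν)) (hD : 2 ≤ D) (hD' : 16 * D ≤ 9 * d ^ 2) :
    4 * (2 * (11 * d ^ 2 * (d + ν + 3) * R ^ 2 : ℕ) + 1 : ℝ) ^ D ≤
      Real.exp (11 * d ^ 2 * (d + ν + 3) / 8) := by
  set u : ℕ := d + ν + 3 with hu
  have hR2 : (R : ℝ) ^ 2 ≤ 4 ^ u / 256 := by
    have h1 : (2 * R : ℝ) ≤ 2 ^ (d + ν) := by exact_mod_cast hR'
    have h2 : (2 * R : ℝ) ^ 2 ≤ (2 ^ (d + ν)) ^ 2 := by gcongr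
    have h3 : (4 : ℝ) ^ u = 64 * (2 ^ (d + ν)) ^ 2 := by
      rw [hu, pow_add, ← pow_mul, mul_comm (d + ν) 2, pow_mul]
      norm_num
      ring
    linarith
  have hexp : (4 : ℝ) ^ u * (u ^ 3 * (45 / 256)) ≤ Real.exp (22 / 9 * u) := by
    have h4 : (4 : ℝ) ^ u = Real.exp (u * (2 * Real.log 2)) := by
      rw [Real.exp_nat_mul, mul_comm 2, Real.exp_mul, Real.exp_log two_pos]
      norm_num
    have h5 : (22 / 9 : ℝ) * u = u * (2 * Real.log 2) + u * (22 / 9 - 2 * Real.log 2) := by ring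
    rw [h5, Real.exp_add, ← h4]
    have h6 : (1.05 : ℝ) ≤ 22 / 9 - 2 * Real.log 2 := by
      have := Real.log_two_lt_d9
      norm_num at this ⊢
      linarith
    have h7 : (u * 1.05 : ℝ) ≤ u * (22 / 9 - 2 * Real.log 2) := by gcongr
    have h8 := Real.pow_div_factorial_le_exp (u * 1.05 : ℝ) (by positivity) 3
    have h9 := Real.exp_le_exp.2 h7
    have h10 : (u : ℝ) ^ 3 * (45 / 256) ≤ (u * 1.05 : ℝ) ^ 3 / (Nat.factorial 3 : ℕ) := by
      have : (0 : ℝ) ≤ (u : ℝ) ^ 3 := by positivity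
      rw [mul_pow]
      norm_num [Nat.factorial]
      linarith
    gcongr
    linarith
  have hbase : 2 * (2 * (11 * d ^ 2 * u * R ^ 2 : ℕ) + 1 : ℝ) ≤ Real.exp (22 / 9 * u) := by
    refine le_trans ?_ hexp
    have hone : 2 ≤ d ^ 2 * u * R ^ 2 := by
      have : 1 ≤ R ^ 2 := Nat.one_le_pow _ _ hR
      have : 4 ≤ d ^ 2 := by nlinarith
      have : 4 * 1 ≤ d ^ 2 * u := Nat.mul_le_mul this (by omega)
      nlinarith
    have hone' : (2 : ℝ) ≤ d ^ 2 * u * R ^ 2 := by exact_mod_cast hone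
    have hdu : (d : ℝ) ≤ u := by exact_mod_cast (by omega : d ≤ u)
    calc 2 * (2 * (11 * d ^ 2 * u * R ^ 2 : ℕ) + 1 : ℝ) ≤ 45 * (d ^ 2 * u * R ^ 2) := by
          push_cast
          linarith
      _ ≤ 45 * ((u : ℝ) ^ 2 * u * (4 ^ u / 256)) := by gcongr
      _ = _ := by ring
  have hu' : ((d : ℝ) + ν + 3) = u := by simp [hu]
  rw [hu']
  calc 4 * (2 * (11 * d ^ 2 * u * R ^ 2 : ℕ) + 1 : ℝ) ^ D
      ≤ 2 ^ D * (2 * (11 * d ^ 2 * u * R ^ 2 : ℕ) + 1 : ℝ) ^ D := by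
        gcongr
        calc (4 : ℝ) = 2 ^ 2 := by norm_num
          _ ≤ 2 ^ D := pow_le_pow_right₀ (by norm_num) hD
    _ = (2 * (2 * (11 * d ^ 2 * u * R ^ 2 : ℕ) + 1 : ℝ)) ^ D := (mul_pow _ _ _).symm
    _ ≤ Real.exp (22 / 9 * u) ^ D := by gcongr
    _ = Real.exp (D * (22 / 9 * u)) := (Real.exp_nat_mul _ _).symm
    _ ≤ _ := by
        refine Real.exp_le_exp.2 ?_
        have h1 : (16 * D : ℝ) ≤ 9 * d ^ 2 := by exact_mod_cast hD'
        have h2 : (16 * D : ℝ) * u ≤ 9 * d ^ 2 * u := by gcongr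
        linarith

/-- The theorem of Ding, Seymour and Winkler, for an indexed family of nonempty sets. -/
theorem exists_hitting_of_no_pairShattered [Fintype ι] [Fintype α] [DecidableEq α]
    (B : ι → Finset α) (hB : ∀ i, (B i).Nonempty) {d ν : ℕ}
    (hν : ∀ S : Finset ι, (S : Set ι).PairwiseDisjoint B → #S ≤ ν)
    (hg : ∀ g : Fin (d + 1) → ι, Function.Injective g → ¬ PairShattered B g) :
    ∃ X : Finset α, #X ≤ 11 * d ^ 2 * (d + ν + 3) * (d + ν).choose d ^ 2 ∧
      ∀ i, ∃ a ∈ X, a ∈ B i := by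
  classical
  rcases isEmpty_or_nonempty ι with hι | ⟨⟨i₀⟩⟩
  · exact ⟨∅, by simp, fun i ↦ isEmptyElim i⟩
  rcases (by omega : d = 0 ∨ d = 1 ∨ 2 ≤ d) with rfl | rfl | hd
  · have : Subsingleton (Fin (0 + 1)) := inferInstanceAs (Subsingleton (Fin 1))
    exact absurd (fun a b hab ↦ absurd (Subsingleton.elim a b) hab)
      (hg (fun _ ↦ i₀) (Function.injective_of_subsingleton _))
  -- Two sets that meet are pair-shattered, as there is no third set; so all sets are disjoint.
  · have hdis : ((univ : Finset ι) : Set ι).PairwiseDisjoint B := by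
      intro i _ j _ hij
      by_contra hnd
      obtain ⟨v, hvi, hvj⟩ := not_disjoint_iff.1 hnd
      refine hg ![i, j] (by simp [Function.Injective, Fin.forall_fin_two, hij, hij.symm])
        fun a b hab ↦ ⟨v, fun h ↦ ?_⟩
      have h1 : v ∈ B (![i, j] h) := by fin_cases h <;> simp [hvi, hvj]
      have h2 : h = a ∨ h = b := by omega
      exact iff_of_true h1 h2
    choose v hv using hB
    refine ⟨univ.image v, ?_, fun i ↦ ⟨v i, mem_image_of_mem v (mem_univ i), hv i⟩⟩
    refine card_image_le.trans ((hν _ hdis).trans ?_)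
    rw [Nat.choose_one_right]
    nlinarith [Nat.zero_le (ν ^ 2), Nat.zero_le (ν ^ 3)]
  have hg' : ∀ g : Fin (d + 1) → ι, ¬ PairShattered B g := fun g h ↦
    hg g (h.injective (by omega)) h
  have : Nonempty ι := ⟨i₀⟩
  have hν1 : 1 ≤ ν := by simpa using hν {i₀} (by simp)
  set R := (d + ν).choose d with hR
  have hR1 : 1 ≤ R := Nat.choose_pos (by omega)
  rcases exists_strategy_or_exists_strategy (fun i a ↦ if a ∈ B i then (1 : ℝ) else 0)
    (1 / (4 * (R : ℝ) ^ 2)) with ⟨p, hp0, hp1, hp⟩ | ⟨q, hq0, hq1, hq⟩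
  swap
  · obtain ⟨g, h⟩ := exists_pairShattered_of_weights B hB hν q hq0 hq1 fun a ↦ (hq a).le
    exact absurd h (hg' g)
  have hchoose : 2 * (d + 1).choose 2 = (d + 1) * d := by
    rw [Nat.choose_two_right, Nat.add_sub_cancel, Nat.mul_div_cancel']
    rw [mul_comm]
    exact (Nat.even_mul_succ_self d).two_dvd
  have hdd : 2 * d ≤ d * d := Nat.mul_le_mul_right d hd
  have hD : 2 ≤ (d + 1).choose 2 - 1 := by
    have : 6 ≤ (d + 1) * d := by nlinarith
    omega
  -- Equivalent to `(d - 4) ^ 2 ≥ 0`, with equality at `d = 4`.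
  have hD' : 16 * ((d + 1).choose 2 - 1) ≤ 9 * d ^ 2 := by
    have h1 : 8 * ((d + 1) * d) ≤ 9 * d ^ 2 + 16 := by
      zify
      nlinarith [sq_nonneg ((d : ℤ) - 4)]
    omega
  have hnum := four_mul_pow_le_exp hd hν1 hR1
    (choose_mul_two_le_two_pow (by omega) (by omega)) hD hD'
  set m : ℕ := 11 * d ^ 2 * (d + ν + 3) * R ^ 2 with hm
  have hεm : 1 / (4 * (R : ℝ) ^ 2) * m / 2 = 11 * d ^ 2 * (d + ν + 3) / 8 := by
    have : (R : ℝ) ≠ 0 := by positivity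
    rw [hm]
    push_cast
    field_simp
    norm_num
  set x : ℝ := 11 * d ^ 2 * (d + ν + 3) / 8 with hx
  have hlog := Real.log_pos (one_lt_two : (1 : ℝ) < 2)
  have hpow : ∀ n : ℕ, (2 : ℝ) ^ n = Real.exp (n * Real.log 2) := fun n ↦ by
    rw [Real.exp_nat_mul, Real.exp_log two_pos]
  -- `k` is the largest exponent with `2 ^ k ≤ exp x`; rounding down loses a factor below `2`,
  -- whence the `4` in `hnum`.
  refine exists_hitting_of_weights B (card_le_of_no_pairShattered B hg') p hp0 hp1 hp
    (k := ⌊x / Real.log 2⌋₊) ?_ ?_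
  · rw [hεm, hpow]
    have := Nat.floor_le (show 0 ≤ x / Real.log 2 by positivity)
    rw [le_div_iff₀ hlog] at this
    exact Real.exp_le_exp.2 this
  · have h1 := Nat.lt_floor_add_one (x / Real.log 2)
    rw [div_lt_iff₀ hlog] at h1
    have h2 := Real.exp_lt_exp.2 h1
    rw [← Nat.cast_add_one, ← hpow, pow_succ] at h2
    have h3 : 2 * (2 * m + 1 : ℝ) ^ ((d + 1).choose 2 - 1) < 2 ^ ⌊x / Real.log 2⌋₊ := by linarith
    exact_mod_cast h3

end HittingSet

/-! ### Balls of a fixed radius in a graph -/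

namespace SimpleGraph

variable {V : Type*} {G : SimpleGraph V}

theorem Hom.edist_le {V' : Type*} {G' : SimpleGraph V'} (f : G →g G') (u v : V) :
    G'.edist (f u) (f v) ≤ G.edist u v := by
  by_cases h : G.edist u v = ⊤
  · simp [h]
  · obtain ⟨p, hp⟩ := exists_walk_of_edist_ne_top h
    rw [← hp, ← p.length_map f]
    exact SimpleGraph.edist_le _

theorem Iso.edist_eq {V' : Type*} {G' : SimpleGraph V'} (f : G ≃g G') (u v : V) :
    G'.edist (f u) (f v) = G.edist u v := by
  refine le_antisymm (f.toHom.edist_le u v) ?_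
  simpa using f.symm.toHom.edist_le (f u) (f v)

theorem exists_edist_le_of_edist_le_two_mul {u v : V} {l : ℕ} (h : G.edist u v ≤ (2 * l : ℕ)) :
    ∃ w, G.edist u w ≤ l ∧ G.edist w v ≤ l := by
  obtain ⟨p, hp⟩ := exists_walk_of_edist_ne_top (ne_top_of_le_ne_top (ENat.natCast_ne_top _) h)
  rw [← hp, Nat.cast_le] at h
  refine ⟨p.getVert l, (edist_le (p.take l)).trans ?_, (edist_le (p.drop l)).trans ?_⟩
  · rw [Walk.take_length]
    exact_mod_cast min_le_left _ _
  · rw [Walk.drop_length, Nat.cast_le]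
    omega

theorem mem_distBall {x y : V} {l : ℕ} : y ∈ G.distBall x l ↔ G.edist x y ≤ l := Iff.rfl

theorem self_mem_distBall (x : V) (l : ℕ) : x ∈ G.distBall x l := by simp [mem_distBall]

theorem card_le_packingNumber [Finite V] (l : ℕ) (S : Finset V)
    (hS : (S : Set V).PairwiseDisjoint fun x ↦ G.distBall x l) :
    S.card ≤ (G.ballHypergraph l).packingNumber := by
  classical
  have := Fintype.ofFinite (Set V)
  have hinj : Set.InjOn (fun x ↦ G.distBall x l) S := fun x hx y hy hxy ↦ by
    by_contra hne
    exact Set.disjoint_left.1 (hS hx hy hne) (self_mem_distBall x l)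
      (hxy ▸ self_mem_distBall x l : x ∈ (fun x ↦ G.distBall x l) y)
  refine le_csSup ⟨Fintype.card (Set V), ?_⟩ ⟨S.image fun x ↦ G.distBall x l, ⟨?_, ?_⟩, ?_⟩
  · rintro _ ⟨M, -, rfl⟩
    exact M.card_le_univ
  · rintro e he
    obtain ⟨x, -, rfl⟩ := Finset.mem_image.1 (Finset.mem_coe.1 he)
    exact ⟨x, rfl⟩
  · rintro e he e' he' hne
    obtain ⟨x, hx, rfl⟩ := Finset.mem_image.1 (Finset.mem_coe.1 he)
    obtain ⟨y, hy, rfl⟩ := Finset.mem_image.1 (Finset.mem_coe.1 he')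
    exact hS hx hy (ne_of_apply_ne (fun x ↦ G.distBall x l) hne)
  · exact Finset.card_image_of_injOn hinj

theorem transversality_le [Finite V] (l : ℕ) (X : Finset V)
    (hX : ∀ x, ∃ y ∈ X, y ∈ G.distBall x l) :
    (G.ballHypergraph l).transversality ≤ X.card := by
  refine Nat.sInf_le ⟨X, ⟨Set.subset_univ _, ?_⟩, rfl⟩
  rintro _ ⟨x, rfl⟩
  obtain ⟨y, hy, hyx⟩ := hX x
  exact ⟨y, hyx, hy⟩

/-- The whole graph is an admissible induced subgraph, and by symmetry of distance the ball around
`v` traces exactly the pair of centres. -/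
theorem le_distTwoVCDim [Finite V] (l : ℕ) {n : ℕ} (g : Fin n → V) (hg : Function.Injective g)
    (h : ∀ a b, a ≠ b → ∃ v, ∀ c, G.edist (g c) v ≤ l ↔ c = a ∨ c = b) :
    n ≤ G.distTwoVCDim := by
  classical
  have hfin : (Set.range fun S : Set V ↦ (G.induce S).allBallsHypergraph.twoVCDim).Finite :=
    Set.finite_range _
  refine le_trans ?_ (le_ciSup hfin.bddAbove Set.univ)
  have := Fintype.ofFinite (Set.univ : Set V)
  let g' : Fin n → (Set.univ : Set V) := fun a ↦ ⟨g a, trivial⟩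
  have hg' : Function.Injective g' := fun a b hab ↦ hg (congrArg Subtype.val hab)
  refine le_csSup ⟨Fintype.card (Set.univ : Set V), ?_⟩
    ⟨Finset.univ.image g', ⟨Set.subset_univ _, fun Y hY hY2 ↦ ?_⟩, ?_⟩
  · rintro _ ⟨M, -, rfl⟩
    exact M.card_le_univ
  · obtain ⟨y, z, hyz, rfl⟩ := Set.ncard_eq_two.1 hY2
    have hmem : ∀ w ∈ ({y, z} : Set _), ∃ a, g' a = w := fun w hw ↦ by simpa using hY hw
    obtain ⟨a, rfl⟩ := hmem y (by simp)
    obtain ⟨b, rfl⟩ := hmem z (by simp)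
    obtain ⟨v, hv⟩ := h a b (ne_of_apply_ne g' hyz)
    refine ⟨_, ⟨⟨v, trivial⟩, l, rfl⟩, ?_⟩
    have hball : ∀ c, g' c ∈ (G.induce Set.univ).distBall ⟨v, trivial⟩ l ↔ c = a ∨ c = b := by
      intro c
      rw [← hv c, mem_distBall, ← G.induceUnivIso.edist_eq, edist_comm]
      rfl
    ext w
    simp only [Set.mem_inter_iff, Finset.coe_image, Finset.coe_univ, Set.image_univ, Set.mem_range,
      Set.mem_insert_iff, Set.mem_singleton_iff]
    constructor
    · rintro ⟨hw, c, rfl⟩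
      exact ((hball c).1 hw).imp (congrArg g') (congrArg g')
    · rintro (rfl | rfl)
      · exact ⟨(hball a).2 (.inl rfl), a, rfl⟩
      · exact ⟨(hball b).2 (.inr rfl), b, rfl⟩
  · rw [Finset.card_image_of_injective _ hg', Finset.card_univ, Fintype.card_fin]

/-- The theorem of Ding, Seymour and Winkler for the balls of a fixed radius in a graph. -/
theorem exists_hitting_distBall [Finite V] (l d ν : ℕ)
    (hν : ∀ S : Finset V, (S : Set V).PairwiseDisjoint (fun x ↦ G.distBall x l) → S.card ≤ ν)
    (hd : ∀ g : Fin (d + 1) → V, Function.Injective g →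
      ¬ ∀ a b, a ≠ b → ∃ v, ∀ c, G.edist (g c) v ≤ l ↔ c = a ∨ c = b) :
    ∃ X : Finset V, X.card ≤ 11 * d ^ 2 * (d + ν + 3) * (d + ν).choose d ^ 2 ∧
      ∀ x, ∃ y ∈ X, y ∈ G.distBall x l := by
  classical
  have := Fintype.ofFinite V
  have hB : ∀ x y, y ∈ (G.distBall x l).toFinset ↔ G.edist x y ≤ l := fun x y ↦ by
    rw [Set.mem_toFinset, mem_distBall]
  obtain ⟨X, hX, h⟩ := exists_hitting_of_no_pairShattered (fun x ↦ (G.distBall x l).toFinset)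
    (fun x ↦ ⟨x, (hB x x).2 (by simp)⟩) (d := d) (ν := ν)
    (fun S hS ↦ hν S fun x hx y hy hxy ↦ Set.disjoint_toFinset.1 (hS hx hy hxy))
    (fun g hg hs ↦ hd g hg fun a b hab ↦ by
      obtain ⟨v, hv⟩ := hs a b hab
      exact ⟨v, fun c ↦ (hB _ _).symm.trans (hv c)⟩)
  exact ⟨X, hX, fun x ↦ by simpa using h x⟩

end SimpleGraph

/-! ### The polynomial bound and the corollary -/

theorem exists_polynomial_eval_eq (d : ℕ) : ∃ p : Polynomial ℚ, p.natDegree ≤ 2 * d + 1 ∧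
    ∀ n : ℕ, p.eval (n : ℚ) = ((11 * d ^ 2 * (d + n + 3) * (d + n).choose d ^ 2 : ℕ) : ℚ) := by
  -- Its degree is `d` and its value at `n` is `(n + d).choose d`.
  let c : Polynomial ℚ := Polynomial.preHilbertPoly ℚ d 0
  refine ⟨Polynomial.C (11 * d ^ 2 : ℚ) * (Polynomial.X + Polynomial.C (d + 3 : ℚ)) * c ^ 2,
    ?_, fun n ↦ ?_⟩
  · refine Polynomial.natDegree_mul_le.trans ?_
    have h1 : (Polynomial.C (11 * d ^ 2 : ℚ) * (Polynomial.X + Polynomial.C (d + 3 : ℚ))).natDegree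
        ≤ 1 := (Polynomial.natDegree_C_mul_le _ _).trans (Polynomial.natDegree_X_add_C _).le
    have h2 : (c ^ 2).natDegree ≤ 2 * d :=
      Polynomial.natDegree_pow_le.trans (by rw [Polynomial.natDegree_preHilbertPoly])
    omega
  · have hc : c.eval (n : ℚ) = (d + n).choose d := by
      rw [add_comm d n]
      simpa using Polynomial.preHilbertPoly_eq_choose_sub_add ℚ d (Nat.zero_le n)
    simp only [Polynomial.eval_mul, Polynomial.eval_pow, Polynomial.eval_add, Polynomial.eval_X,
      Polynomial.eval_C, hc]
    push_cast
    ring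

theorem corollary4p2 {V : Type*} [Finite V] (G : SimpleGraph V) :
    (∀ d l : ℕ, G.distTwoVCDim ≤ d →
      (G.ballHypergraph l).transversality ≤
        11 * d ^ 2 * (d + (G.ballHypergraph l).packingNumber + 3) *
          (d + (G.ballHypergraph l).packingNumber).choose d ^ 2) ∧
    (∀ d : ℕ, ∃ p : Polynomial ℚ, p.natDegree ≤ 2 * d + 1 ∧
      ∀ n : ℕ, p.eval (n : ℚ) =
        ((11 * d ^ 2 * (d + n + 3) * (d + n).choose d ^ 2 : ℕ) : ℚ)) ∧
    (∀ l : ℕ, G.IsPlanar → G.ediam ≤ ((2 * l : ℕ) : ℕ∞) →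
      ∃ D : Finset V, G.IsDominatingAt l ↑D ∧ D.card ≤ 35200) := by
  refine ⟨fun d l hd ↦ ?_, exists_polynomial_eval_eq, fun l hG hl ↦ ?_⟩
  · obtain ⟨X, hX, h⟩ := SimpleGraph.exists_hitting_distBall (G := G) l d _
      (SimpleGraph.card_le_packingNumber l) fun g hg hs ↦ by
        have := SimpleGraph.le_distTwoVCDim l g hg hs
        omega
    exact (SimpleGraph.transversality_le l X h).trans hX
  · have hν : ∀ S : Finset V, (S : Set V).PairwiseDisjoint (fun x ↦ G.distBall x l) →
        S.card ≤ 1 := by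
      intro S hS
      rw [Finset.card_le_one]
      intro x hx y hy
      by_contra hne
      obtain ⟨w, hxw, hwy⟩ := SimpleGraph.exists_edist_le_of_edist_le_two_mul
        (SimpleGraph.edist_le_ediam.trans hl : G.edist x y ≤ _)
      rw [SimpleGraph.edist_comm] at hwy
      exact Set.disjoint_left.1 (hS hx hy hne) hxw hwy
    -- For `d = 4` and `ν = 1` the bound is `11 * 16 * 8 * 5 ^ 2 = 35200`.
    obtain ⟨X, hX, h⟩ := SimpleGraph.exists_hitting_distBall (G := G) l 4 1 hν
      fun g _ hs ↦ hG.not_pairs_fin_five l g fun a b hab ↦ by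
        simpa only [SimpleGraph.edist_comm] using hs a b hab
    refine ⟨X, fun v ↦ ?_, hX⟩
    obtain ⟨y, hy, hyv⟩ := h v
    exact ⟨y, hy, by rwa [SimpleGraph.edist_comm]⟩
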